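/- Let $U\subseteq\mathbb R^n$ be open, $T^*U=U\times\mathbb R^n$, and let $W\subseteq\mathbb C$ be open and connected with $0\in W$ (for instance $W=\mathbb C$). Fix a smooth function $\chi$ of $\xi$ with $\chi(\xi)=0$ for $|\xi|\le 1/2$ and $\chi(\xi)=1$ for $|\xi|\ge 1$ ($|\cdot|$ the Euclidean norm). For $m\in\mathbb C$ let $CS^m_{\rm com}(U)$ be the set of classical symbols $\sigma\sim\sum_{j\ge0}\chi\,\sigma_{m-j}$ of order $m$ on $U$, with compact support in $x\in U$; here $\sigma_{m-j}$ is smooth on $U\times(\mathbb R^n\setminus0)$ and positively homogeneous of degree $m-j$ in $\xi$, and $\sigma_{(N)}=\sigma-\sum_{j<N}\chi\sigma_{m-j}$ is a symbol of order $\operatorname{Re}m-N$ for all $N$. A *holomorphic family of order* $\alpha(z)$, $z\in W$ ($\alpha$ holomorphic on $W$), is a family $\sigma(z)\in CS^{\alpha(z)}_{\rm com}(U)$ such that each component $z\mapsto\sigma_{\alpha(z)-j}(z)$ is holomorphic with values in $C^\infty(U\times(\mathbb R^n\setminus0))$ and, for all $N\ge1$, the remainder $\sigma_{(N)}(z)$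 is holomorphic with values in $C^\infty(U\times\mathbb R^n)$, all its $z$-derivatives $\partial_z^k\sigma_{(N)}(z)$ satisfying, for every $\varepsilon>0$, the estimates of symbols of order $\operatorname{Re}\alpha(z)-N+\varepsilon$, locally uniformly in $z$. A *holomorphic regularisation* $\mathcal R$ assigns to each $\sigma\in\bigcup_m CS^m_{\rm com}(U)$ a holomorphic family $\sigma(z)$ of some order $\alpha_\sigma(z)$ with $\sigma(0)=\sigma$ and $\alpha_\sigma'(0)\ne0$. On forms $\omega=\sum_{I,J}\omega_{IJ}\,dx_I\wedge d\xi_J$ with such coefficients it induces $\omega(z)=\sum_{I,J}\omega_{IJ}(z)\,dx_I\wedge d\xi_J$; the family $\omega(z)$ has holomorphic order $\alpha(z)$ if each $\omega_{IJ}(z)$ is a holomorphic family of order $\alpha(z)-|J|$. The cut-off integral (finite part) $\mathrm{fp}\!\!\int_{T_x^*U}\sigma\,d\xi$ is the constant term in the expansion of $\int_{|\xi|<R}\sigma(x,\xi)\,d\xi$ as $R\to\infty$ in a constant, powers $R^{\lambda}$ with $\lambda\in\mathbb C\setminus\{0\}$, and $\log R$. For forms, with $[n]=\{1,\dots,n\}$,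 $$\mathrm{fp}\!\!\int_{T_x^*U}\omega=\sum_I\Big(\mathrm{fp}\!\!\int_{T_x^*U}\omega_{I,[n]}\,d\xi\Big)dx_I,\qquad \mathrm{fp}\!\!\int_{T^*U}\omega=\int_U\Big(\mathrm{fp}\!\!\int_{T_x^*U}\omega_{[n],[n]}\,d\xi\Big)dx.$$ With ${\rm res}_x(\sigma)=\int_{|\xi|=1}\sigma_{-n}(x,\xi)\,d_S\xi$ (where $\sigma_{-n}$ is the component of degree $-n$, zero if there is none), the extended Wodzicki residues are $${\rm res}_x(\omega)=\sum_I{\rm res}_x(\omega_{I,[n]})\,dx_I,\qquad {\rm res}(\omega)=\int_U{\rm res}_x(\omega_{[n],[n]})\,dx.$$ **Theorem.** Let $\mathcal R$ be a holomorphic regularisation, $\omega$ a form with coefficients in $\bigcup_m CS^m_{\rm com}(U)$, and suppose that $\omega(z)$ has holomorphic order $\alpha(z)$ with $\alpha'(0)\neq0$. Then for every $x\in U$ the cut-off integrals $\mathrm{fp}\!\!\int_{T_x^*U}\omega(z)$ and $\mathrm{fp}\!\!\int_{T^*U}\omega(z)$ are well defined for all $z\in W$ (the finite parts exist; the integrands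 over $U$ defining $\mathrm{fp}\!\!\int_{T^*U}\omega(z)$ and ${\rm res}(\omega(z))$ are integrable), and both are meromorphic functions of $z\in W$, holomorphic at every point outside $\alpha^{-1}([-n,+\infty)\cap\mathbb Z)$. At every $z_0\in W$ with $\alpha'(z_0)\ne0$ they have at most a simple pole, with $${\rm Res}_{z=z_0}\mathrm{fp}\!\!\int_{T_x^*U}\omega(z)=-\frac1{\alpha'(z_0)}{\rm res}_x(\omega(z_0)),\qquad {\rm Res}_{z=z_0}\mathrm{fp}\!\!\int_{T^*U}\omega(z)=-\frac1{\alpha'(z_0)}{\rm res}(\omega(z_0)).$$ In particular, at $z_0=0$ the residues are $-\frac1{\alpha'(0)}{\rm res}_x(\omega(0))$ and $-\frac1{\alpha'(0)}{\rm res}(\omega(0))$. -/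

import Mathlib

open Set Filter Topology MeasureTheory

namespace SymbolForms

noncomputable section

/-- The model space `ℝⁿ` with its Euclidean norm. For `U ⊆ ℝⁿ` open, the cotangent bundle `T*U` is
`U × ℝⁿ`; a point of it is a pair `(x, ξ)`. -/
abbrev Eucl (n : ℕ) : Type := EuclideanSpace ℝ (Fin n)

/-! ### Symbols -/

/-- The coordinate directions of `ℝⁿ × ℝⁿ`: `inl i` is `∂/∂x_i` and `inr i` is `∂/∂ξ_i`. -/
def coordDir {n : ℕ} : Fin n ⊕ Fin n → Eucl n × Eucl n
  | Sum.inl i => (EuclideanSpace.single i 1, 0)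
  | Sum.inr i => (0, EuclideanSpace.single i 1)

/-- The iterated partial derivative of `f` in the coordinate directions listed by `s`. -/
def mixedPartial {n k : ℕ} (s : Fin k → Fin n ⊕ Fin n) (f : Eucl n × Eucl n → ℂ)
    (p : Eucl n × Eucl n) : ℂ :=
  iteratedFDeriv ℝ k f p (fun i => coordDir (s i))

/-- The number of derivatives in `ξ`-directions in the list `s`. -/
def fibreCount {n k : ℕ} (s : Fin k → Fin n ⊕ Fin n) : ℕ :=
  (Finset.univ.filter (fun i => (s i).isRight = true)).card

/-- `f ∈ S^m(U)`: the scalar symbols of real order `m` on `U`. -/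
def IsSymbol {n : ℕ} (U : Set (Eucl n)) (m : ℝ) (f : Eucl n × Eucl n → ℂ) : Prop :=
  ContDiffOn ℝ (⊤ : ℕ∞) f (U ×ˢ univ) ∧
    ∀ K : Set (Eucl n), IsCompact K → K ⊆ U →
      ∀ (k : ℕ) (s : Fin k → Fin n ⊕ Fin n), ∃ C : ℝ, ∀ x ∈ K, ∀ ξ : Eucl n,
        ‖mixedPartial s f (x, ξ)‖ ≤ C * (1 + ‖ξ‖) ^ (m - (fibreCount s : ℝ))

/-- A smooth excision function: it vanishes for `‖ξ‖ ≤ 1/2` and equals `1` for `‖ξ‖ ≥ 1`. -/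
def excision {n : ℕ} (ξ : Eucl n) : ℝ :=
  Real.smoothTransition ((4 * ‖ξ‖ ^ 2 - 1) / 3)

/-- The remainder `σ_(N) = σ - ∑_{j < N} χ a_j`. -/
def symbolRemainder {n : ℕ} (σ : Eucl n × Eucl n → ℂ) (a : ℕ → Eucl n × Eucl n → ℂ) (N : ℕ) :
    Eucl n × Eucl n → ℂ :=
  fun p => σ p - ∑ j ∈ Finset.range N, (excision p.2 : ℂ) * a j p

/-- `σ` is a classical symbol on `U` of complex order `m`, and `a j` is its positively homogeneous
component of degree `m - j` (a smooth function on `T*U` minus the zero section):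
`σ ∼ ∑ χ a_j`. For `N = 0` the last clause says that `σ` is a symbol of order `Re m`. -/
structure IsClassicalExpansion {n : ℕ} (U : Set (Eucl n)) (m : ℂ) (σ : Eucl n × Eucl n → ℂ)
    (a : ℕ → Eucl n × Eucl n → ℂ) : Prop where
  smooth : ∀ j, ContDiffOn ℝ (⊤ : ℕ∞) (a j) (U ×ˢ {0}ᶜ)
  homogeneous : ∀ j, ∀ x ∈ U, ∀ ξ : Eucl n, ξ ≠ 0 → ∀ t : ℝ, 0 < t →
    a j (x, t • ξ) = (t : ℂ) ^ (m - (j : ℂ)) * a j (x, ξ)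
  remainder : ∀ N : ℕ, IsSymbol U (m.re - (N : ℝ)) (symbolRemainder σ a N)

/-- Compact support in `U`: `σ(x, ξ) = 0` for `x` outside some compact subset of `U`
(in particular `σ` is extended by `0` outside `U`). -/
def HasCompactSupportIn {n : ℕ} (U : Set (Eucl n)) (σ : Eucl n × Eucl n → ℂ) : Prop :=
  ∃ K : Set (Eucl n), IsCompact K ∧ K ⊆ U ∧ ∀ x, x ∉ K → ∀ ξ, σ (x, ξ) = 0

/-- `σ ∈ CS^m_com(U)`. -/
def IsClassicalCom {n : ℕ} (U : Set (Eucl n)) (m : ℂ) (σ : Eucl n × Eucl n → ℂ) : Prop :=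
  (∃ a, IsClassicalExpansion U m σ a) ∧ HasCompactSupportIn U σ

/-- Classical symbols with compact support in `U`, of any complex order. -/
def ClassicalSymbol {n : ℕ} (U : Set (Eucl n)) : Type :=
  {σ : Eucl n × Eucl n → ℂ // ∃ m : ℂ, IsClassicalCom U m σ}

/-! ### Holomorphic families and regularisations -/

/-- `z ↦ h z` is holomorphic on `W` as a map with values in `C^∞(Ω)`: it is jointly smooth, and
holomorphic in `z` at every point of `Ω`. -/
def IsHolomorphicSmooth {n : ℕ} (W : Set ℂ) (Ω : Set (Eucl n × Eucl n))
    (h : ℂ → Eucl n × Eucl n → ℂ) : Prop :=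
  ContDiffOn ℝ (⊤ : ℕ∞) (fun q : ℂ × (Eucl n × Eucl n) => h q.1 q.2) (W ×ˢ Ω) ∧
    ∀ p ∈ Ω, DifferentiableOn ℂ (fun z => h z p) W

/-- `z ↦ f z` has values in symbols of order `m z`, with symbol estimates that are locally uniform
in `z ∈ W`. -/
def IsLocallyUniformSymbol {n : ℕ} (U : Set (Eucl n)) (W : Set ℂ) (m : ℂ → ℝ)
    (f : ℂ → Eucl n × Eucl n → ℂ) : Prop :=
  (∀ z ∈ W, IsSymbol U (m z) (f z)) ∧
    ∀ z₀ ∈ W, ∀ K : Set (Eucl n), IsCompact K → K ⊆ U →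
      ∀ (k : ℕ) (s : Fin k → Fin n ⊕ Fin n), ∃ C : ℝ, ∀ᶠ z in 𝓝 z₀, ∀ x ∈ K, ∀ ξ : Eucl n,
        ‖mixedPartial s (f z) (x, ξ)‖ ≤ C * (1 + ‖ξ‖) ^ (m z - (fibreCount s : ℝ))

/-- `z ↦ σ z` is a holomorphic family on `W` of classical symbols with compact support in `U`, of
holomorphic order `α`: each homogeneous component is holomorphic in `z`, and for `N ≥ 1` the
remainder `σ_(N)(z)` is holomorphic in `z`, with all `z`-derivatives symbols of order
`α(z) - N + ε` for every `ε > 0`. -/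
def HasHolomorphicOrder {n : ℕ} (U : Set (Eucl n)) (W : Set ℂ) (α : ℂ → ℂ)
    (σ : ℂ → Eucl n × Eucl n → ℂ) : Prop :=
  DifferentiableOn ℂ α W ∧
  (∀ z ∈ W, HasCompactSupportIn U (σ z)) ∧
  ∃ a : ℕ → ℂ → Eucl n × Eucl n → ℂ,
    (∀ z ∈ W, IsClassicalExpansion U (α z) (σ z) (fun j => a j z)) ∧
    (∀ j, IsHolomorphicSmooth W (U ×ˢ {0}ᶜ) (a j)) ∧
    ∀ N : ℕ, 1 ≤ N →
      IsHolomorphicSmooth W (U ×ˢ univ) (fun z => symbolRemainder (σ z) (fun j => a j z) N) ∧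
      ∀ (k : ℕ) (ε : ℝ), 0 < ε →
        IsLocallyUniformSymbol U W (fun z => (α z).re - (N : ℝ) + ε)
          (fun z p =>
            iteratedDeriv k (fun w => symbolRemainder (σ w) (fun j => a j w) N p) z)

/-- A holomorphic regularisation procedure `σ ↦ σ(z)`, `z ∈ W`, on classical symbols with compact
support in `U`. -/
structure HolomorphicRegularisation {n : ℕ} (U : Set (Eucl n)) (W : Set ℂ) where
  toFun : ClassicalSymbol U → ℂ → Eucl n × Eucl n → ℂ
  apply_zero : ∀ σ, toFun σ 0 = σ.1
  exists_order : ∀ σ, ∃ α : ℂ → ℂ, HasHolomorphicOrder U W α (toFun σ) ∧ deriv α 0 ≠ 0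

/-! ### Forms on `T*U` -/

/-- A form `∑_{I,J} ω_{IJ}(x, ξ) dx_I ∧ dξ_J` on the cotangent bundle, given by its coefficients
`ω I J`; here `dx_I` and `dξ_J` are the products in increasing order. All degrees are allowed at
once. -/
abbrev PhaseForm (n : ℕ) : Type :=
  Finset (Fin n) → Finset (Fin n) → Eucl n × Eucl n → ℂ

/-- A form whose coefficients are classical symbols with compact support in `U`. -/
abbrev SymbolForm {n : ℕ} (U : Set (Eucl n)) : Type :=
  Finset (Fin n) → Finset (Fin n) → ClassicalSymbol U

/-- The regularisation of forms induced by one of symbols: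
`ω(z) = ∑ ω_{IJ}(z) dx_I ∧ dξ_J`. -/
def HolomorphicRegularisation.onForms {n : ℕ} {U : Set (Eucl n)} {W : Set ℂ}
    (R : HolomorphicRegularisation U W) (ω : SymbolForm U) (z : ℂ) : PhaseForm n :=
  fun I J => R.toFun (ω I J) z

/-- The family of forms `ω(z)` has holomorphic order `α`: each coefficient `ω_{IJ}(z)` has
holomorphic order `α(z) - |J|`. -/
def FormHasHolomorphicOrder {n : ℕ} (U : Set (Eucl n)) (W : Set ℂ) (α : ℂ → ℂ)
    (ω : ℂ → PhaseForm n) : Prop :=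
  ∀ I J, HasHolomorphicOrder U W (fun z => α z - (J.card : ℂ)) (fun z => ω z I J)

/-! ### Cut-off integrals -/

/-- `c` is the finite part of `F(r)` as `r → ∞`: the constant term of an expansion
`F(r) = c + ∑_{λ ∈ s} a_λ r^λ + b log r + o(1)` with finitely many exponents `λ ≠ 0`. -/
def HasFinitePart (F : ℝ → ℂ) (c : ℂ) : Prop :=
  ∃ (s : Finset ℂ) (a : ℂ → ℂ) (b : ℂ), (0 : ℂ) ∉ s ∧
    Tendsto (fun r : ℝ => F r - ∑ l ∈ s, a l * (r : ℂ) ^ l - b * (Real.log r : ℂ)) atTop (𝓝 c)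

open Classical in
/-- The finite part of `F(r)` as `r → ∞` (and `0` if there is none). -/
def finitePart (F : ℝ → ℂ) : ℂ :=
  if h : ∃ c, HasFinitePart F c then h.choose else 0

/-- The integral of `σ(x, ·)` over the ball of radius `r` in the cotangent space at `x`. -/
def ballIntegral {n : ℕ} (σ : Eucl n × Eucl n → ℂ) (x : Eucl n) (r : ℝ) : ℂ :=
  ∫ ξ in Metric.ball (0 : Eucl n) r, σ (x, ξ)

/-- The cut-off integral of `σ(x, ·)` over the cotangent space at `x`. -/
def cutoffIntegral {n : ℕ} (σ : Eucl n × Eucl n → ℂ) (x : Eucl n) : ℂ :=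
  finitePart (ballIntegral σ x)

/-- The cut-off integral of a form over the fibre `T*_xU`: only the coefficients with `|J| = n`
contribute, and the result is the form `∑_I (⨍ ω_{IJ}(x, ξ) dξ) dx_I` at `x`, given by its
coefficients. -/
def fibreCutoff {n : ℕ} (ω : PhaseForm n) (x : Eucl n) : Finset (Fin n) → ℂ :=
  fun I => cutoffIntegral (ω I Finset.univ) x

/-- The cut-off integral of a form over `T*U`: only the coefficient with `|I| = |J| = n`
contributes. -/
def totalCutoff {n : ℕ} (U : Set (Eucl n)) (ω : PhaseForm n) : ℂ :=
  ∫ x in U, cutoffIntegral (ω Finset.univ Finset.univ) x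

/-! ### The Wodzicki residue -/

/-- `b` is a positively homogeneous component of degree `d` of the classical symbol `σ`. -/
def IsComponent {n : ℕ} (U : Set (Eucl n)) (σ : Eucl n × Eucl n → ℂ) (d : ℂ)
    (b : Eucl n × Eucl n → ℂ) : Prop :=
  ∃ (m : ℂ) (a : ℕ → Eucl n × Eucl n → ℂ) (j : ℕ),
    IsClassicalExpansion U m σ a ∧ m - (j : ℂ) = d ∧ a j = b

open Classical in
/-- The positively homogeneous component of degree `d` of a classical symbol `σ`; it is `0` if no
term of degree `d` occurs in an expansion of `σ`. (It is unique over `U`, away from `ξ = 0`.) -/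
def component {n : ℕ} (U : Set (Eucl n)) (σ : Eucl n × Eucl n → ℂ) (d : ℂ) :
    Eucl n × Eucl n → ℂ :=
  if h : ∃ b, IsComponent U σ d b then h.choose else 0

/-- The local Wodzicki residue density `res_x(σ) = ∫_{|ξ| = 1} σ_{-n}(x, ξ) d_Sξ`. -/
def residueDensity {n : ℕ} (U : Set (Eucl n)) (σ : Eucl n × Eucl n → ℂ) (x : Eucl n) : ℂ :=
  ∫ ξ : Metric.sphere (0 : Eucl n) 1, component U σ (-(n : ℂ)) (x, (ξ : Eucl n))
    ∂((volume : Measure (Eucl n)).toSphere)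

/-- The extended residue density of a form: `res_x(ω) = ∑_{I, |J| = n} res_x(ω_{IJ}) dx_I`, given
by its coefficients. -/
def fibreResidue {n : ℕ} (U : Set (Eucl n)) (ω : PhaseForm n) (x : Eucl n) :
    Finset (Fin n) → ℂ :=
  fun I => residueDensity U (ω I Finset.univ) x

/-- The extended Wodzicki residue of a form: only the coefficient with `|I| = |J| = n`
contributes. -/
def totalResidue {n : ℕ} (U : Set (Eucl n)) (ω : PhaseForm n) : ℂ :=
  ∫ x in U, residueDensity U (ω Finset.univ Finset.univ) x

/-! ### Poles -/

/-- Near `z₀`, `f` has at most a simple pole, with residue `r` at `z₀`. -/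
def HasSimplePoleWithResidue {V : Type*} [NormedAddCommGroup V] [NormedSpace ℂ V]
    (f : ℂ → V) (z₀ : ℂ) (r : V) : Prop :=
  ∃ g : ℂ → V, AnalyticAt ℂ g z₀ ∧ ∀ᶠ z in 𝓝[≠] z₀, f z = (z - z₀)⁻¹ • r + g z

/-- The set `[-n, ∞) ∩ ℤ`, as a set of complex numbers. -/
def poleOrders (n : ℕ) : Set ℂ :=
  {w | ∃ k : ℤ, -(n : ℤ) ≤ k ∧ w = (k : ℂ)}

end

end SymbolForms

open SymbolForms

/-! Only coefficients with `|J| = n` enter, and these have order `α(z) - n`. Write such a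
coefficient as `∑_{j<N} χ a_j + σ_(N)`. Once `N` exceeds `Re α` near `z₀` by a margin, the remainder
is integrable over the fibre, with a bound uniform in `z`, so its integral is holomorphic. Each `χ
a_j` is split at the unit sphere. The part over the unit ball is holomorphic. Outside the ball `χ =
1` and `a_j` is homogeneous of degree `α - n - j`, so polar coordinates give `S_j ∫_1^r s^(α-j-1)
ds`, where `S_j` is the integral of `a_j` over the sphere. The finite part of this is `-(α-j)⁻¹
S_j`.

Hence the cut-off integral is locally `A - ∑_{j<N} (α-j)⁻¹ S_j` with `A` and `S_j` holomorphic
(`exists_local_formula`). Poles can occur only where `α` takes a value `j ∈ ℕ`. If `α' ≠ 0` there,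
the pole is at most simple with residue `-S_j / α'`, and `S_j` is then the residue density because
`a_j` has degree `-n`.

Two points make this rigorous. Finite parts and homogeneous components must be unique, since both
are defined by choice; both facts follow from the independence of the powers `r^λ`, `λ ≠ 0`, `log r`
and constants at infinity. For the integral over `U`, the local formula is integrated over a compact
set. This needs one support valid for all `z`, obtained from Baire's theorem and the identity
theorem. -/

/-! ### Finite parts: uniqueness and algebra. -/

theorem exists_pos_exp_mul_ne_one {l : ℂ} (hl : l ≠ 0) : ∃ t : ℝ, Complex.exp (t * l) ≠ 1 := by
  -- For this `t` the exponent has norm 1, while the nonzero elements of `2πiℤ` have norm at least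
  -- `2π`.
  refine ⟨1 / ‖l‖, fun h => ?_⟩
  obtain ⟨k, hk⟩ := Complex.exp_eq_one_iff.1 h
  have h1 := congrArg norm hk
  have hl' : ‖l‖ ≠ 0 := norm_ne_zero_iff.2 hl
  simp only [norm_mul, Complex.norm_real, Complex.norm_intCast, Complex.norm_I, Complex.norm_two,
    norm_div, norm_one, mul_one, Real.norm_eq_abs, abs_norm, abs_of_pos Real.pi_pos] at h1
  rw [one_div, inv_mul_cancel₀ hl'] at h1
  rcases eq_or_ne k 0 with rfl | hk0
  · simp at h1
  · have h2 : (1 : ℝ) ≤ |(k : ℝ)| := by exact_mod_cast Int.one_le_abs hk0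
    nlinarith [Real.pi_gt_three]

/-- Induction on the number of exponents by rescaling. Replacing `r` by `q r` and subtracting `q^m`
times the original sum removes the exponent `m` and turns the limit `c` into `(1 - q^m) c`.
Oscillating exponents, with `Re λ = 0`, are covered because `q` can be chosen with `q^m ≠ 1`. -/
theorem tendsto_sum_cpow_eq_zero (s : Finset ℂ) : (0 : ℂ) ∉ s → ∀ (a : ℂ → ℂ) (c : ℂ),
    Tendsto (fun r : ℝ => ∑ l ∈ s, a l * (r : ℂ) ^ l) atTop (𝓝 c) → c = 0 := by
  induction s using Finset.induction_on with
  | empty =>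
    intro _ a c h
    simp only [Finset.sum_empty] at h
    exact tendsto_nhds_unique h tendsto_const_nhds
  | insert m s hm ih =>
    intro h0 a c h
    have hm0 : m ≠ 0 := fun e => h0 (by simp [e])
    obtain ⟨t, ht⟩ := exists_pos_exp_mul_ne_one hm0
    set q : ℝ := Real.exp t with hq
    have hqpos : 0 < q := Real.exp_pos t
    have hqm : (q : ℂ) ^ m ≠ 1 := by
      rwa [hq, Complex.ofReal_exp, Complex.cpow_def_of_ne_zero (Complex.exp_ne_zero _),
        ← Complex.ofReal_exp, ← Complex.ofReal_log hqpos.le, Real.log_exp]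
    have h1 : Tendsto (fun r : ℝ => ∑ l ∈ insert m s, a l * ((q * r : ℝ) : ℂ) ^ l) atTop (𝓝 c) :=
      h.comp (tendsto_id.const_mul_atTop hqpos)
    have h2 := h1.sub (h.const_mul ((q : ℂ) ^ m))
    have h3 := ih (fun e => h0 (by simp [e])) (fun l => a l * ((q : ℂ) ^ l - (q : ℂ) ^ m))
      (c - (q : ℂ) ^ m * c) (by
        refine h2.congr' ?_
        filter_upwards [eventually_ge_atTop 0] with r hr
        rw [Finset.mul_sum, ← Finset.sum_sub_distrib, Finset.sum_insert hm]
        have e : ∀ l : ℂ, a l * ((q * r : ℝ) : ℂ) ^ l - (q : ℂ) ^ m * (a l * (r : ℂ) ^ l)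
            = a l * ((q : ℂ) ^ l - (q : ℂ) ^ m) * (r : ℂ) ^ l := by
          intro l
          rw [Complex.ofReal_mul, Complex.mul_cpow_ofReal_nonneg hqpos.le hr]
          ring
        simp only [e]
        simp)
    have h4 : (1 - (q : ℂ) ^ m) * c = 0 := by linear_combination h3
    exact (mul_eq_zero.1 h4).resolve_left (sub_ne_zero.2 hqm.symm)

namespace SymbolForms

theorem HasFinitePart.of_tendsto {F : ℝ → ℂ} {c : ℂ} (h : Tendsto F atTop (𝓝 c)) :
    HasFinitePart F c :=
  ⟨∅, 0, 0, by simp, by simpa using h⟩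

theorem HasFinitePart.congr' {F G : ℝ → ℂ} {c : ℂ} (h : HasFinitePart F c) (e : F =ᶠ[atTop] G) :
    HasFinitePart G c := by
  obtain ⟨s, a, b, h0, h⟩ := h
  refine ⟨s, a, b, h0, h.congr' ?_⟩
  filter_upwards [e] with r hr
  rw [hr]

theorem HasFinitePart.add {F G : ℝ → ℂ} {c d : ℂ} (hF : HasFinitePart F c)
    (hG : HasFinitePart G d) : HasFinitePart (fun r => F r + G r) (c + d) := by
  classical
  obtain ⟨s, a, b, h0, h⟩ := hF
  obtain ⟨s', a', b', h0', h'⟩ := hG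
  refine ⟨s ∪ s', fun l => (if l ∈ s then a l else 0) + (if l ∈ s' then a' l else 0), b + b',
    by simp [h0, h0'], (h.add h').congr fun r => ?_⟩
  have e1 : ∑ l ∈ s, a l * (r : ℂ) ^ l = ∑ l ∈ s ∪ s', (if l ∈ s then a l else 0) * (r : ℂ) ^ l := by
    rw [← Finset.sum_subset Finset.subset_union_left (fun x _ hx => by simp [hx])]
    exact Finset.sum_congr rfl fun l hl => by simp [hl]
  have e2 : ∑ l ∈ s', a' l * (r : ℂ) ^ l
      = ∑ l ∈ s ∪ s', (if l ∈ s' then a' l else 0) * (r : ℂ) ^ l := by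
    rw [← Finset.sum_subset Finset.subset_union_right (fun x _ hx => by simp [hx])]
    exact Finset.sum_congr rfl fun l hl => by simp [hl]
  rw [e1, e2]
  simp only [add_mul, Finset.sum_add_distrib]
  ring

theorem HasFinitePart.const_mul {F : ℝ → ℂ} {c : ℂ} (k : ℂ) (hF : HasFinitePart F c) :
    HasFinitePart (fun r => k * F r) (k * c) := by
  obtain ⟨s, a, b, h0, h⟩ := hF
  refine ⟨s, fun l => k * a l, k * b, h0, (h.const_mul k).congr fun r => ?_⟩
  simp only [mul_sub, Finset.mul_sum, mul_assoc]

theorem HasFinitePart.sum {ι : Type*} (t : Finset ι) {F : ι → ℝ → ℂ} {c : ι → ℂ}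
    (h : ∀ i ∈ t, HasFinitePart (F i) (c i)) :
    HasFinitePart (fun r => ∑ i ∈ t, F i r) (∑ i ∈ t, c i) := by
  classical
  induction t using Finset.induction_on with
  | empty => simpa using HasFinitePart.of_tendsto tendsto_const_nhds
  | insert i t hi ih =>
    simp only [Finset.sum_insert hi]
    exact (h i (by simp)).add (ih fun j hj => h j (by simp [hj]))

theorem hasFinitePart_cpow {l : ℂ} (hl : l ≠ 0) : HasFinitePart (fun r => (r : ℂ) ^ l) 0 :=
  ⟨{l}, 1, 0, by simpa using hl.symm, by simp⟩

theorem hasFinitePart_log : HasFinitePart (fun r => (Real.log r : ℂ)) 0 :=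
  ⟨∅, 0, 1, by simp, by simp⟩

theorem HasFinitePart.eq_zero {c : ℂ} (h : HasFinitePart (fun _ => 0) c) : c = 0 := by
  obtain ⟨s, a, b, h0, h⟩ := h
  have hb : b = 0 := by
    -- Passing from `r` to `e r` and subtracting turns `b log r` into the constant `b` and only
    -- changes the coefficients of the powers.
    have h1 := (h.comp (tendsto_id.const_mul_atTop (Real.exp_pos 1))).sub h
    simp only [sub_self] at h1
    refine neg_eq_zero.1 (tendsto_sum_cpow_eq_zero s h0
      (fun l => a l * (((Real.exp 1 : ℝ) : ℂ) ^ l - 1)) (-b) ?_)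
    have h2 := h1.neg.sub_const b
    rw [neg_zero, zero_sub] at h2
    refine h2.congr' ?_
    filter_upwards [eventually_gt_atTop 0] with r hr
    have e : ∀ l : ℂ, a l * ((Real.exp 1 * r : ℝ) : ℂ) ^ l
        = a l * (((Real.exp 1 : ℝ) : ℂ) ^ l - 1) * (r : ℂ) ^ l + a l * (r : ℂ) ^ l := by
      intro l
      rw [Complex.ofReal_mul, Complex.mul_cpow_ofReal_nonneg (Real.exp_pos 1).le hr.le]
      ring
    simp only [Function.comp, id, e, Finset.sum_add_distrib,
      Real.log_mul (Real.exp_pos 1).ne' hr.ne', Real.log_exp]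
    push_cast
    ring
  subst hb
  have h2 := tendsto_sum_cpow_eq_zero s h0 a (-c) (h.neg.congr fun r => by simp)
  simpa using h2

theorem HasFinitePart.unique {F : ℝ → ℂ} {c d : ℂ} (hc : HasFinitePart F c)
    (hd : HasFinitePart F d) : c = d := by
  have h := (hc.add (hd.const_mul (-1))).congr' (G := fun _ => 0) (by
    filter_upwards with r
    ring)
  linear_combination h.eq_zero

theorem HasFinitePart.finitePart_eq {F : ℝ → ℂ} {c : ℂ} (h : HasFinitePart F c) :
    finitePart F = c := by
  have h' : ∃ c, HasFinitePart F c := ⟨c, h⟩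
  rw [finitePart, dif_pos h']
  exact h'.choose_spec.unique h

end SymbolForms

/-! ### Holomorphic dependence of integrals on a parameter. -/

/-- Cauchy's estimate on discs of radius `δ` bounds the `z`-derivative by `g / δ`, so domination of
`F` itself is enough to differentiate under the integral. -/
theorem differentiableOn_integral_of_dominated {X : Type*} [MeasurableSpace X] {μ : Measure X}
    {V : Set ℂ} (hV : IsOpen V) {F : ℂ → X → ℂ} {g : X → ℝ}
    (hm : ∀ z ∈ V, AEStronglyMeasurable (F z) μ)
    (hd : ∀ᵐ x ∂μ, DifferentiableOn ℂ (fun z => F z x) V)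
    (hb : ∀ᵐ x ∂μ, ∀ z ∈ V, ‖F z x‖ ≤ g x) (hg : Integrable g μ) :
    DifferentiableOn ℂ (fun z => ∫ x, F z x ∂μ) V := by
  intro z hz
  obtain ⟨δ, hδ, hδV⟩ : ∃ δ > 0, Metric.ball z (3 * δ) ⊆ V := by
    obtain ⟨ε, hε, h⟩ := Metric.isOpen_iff.1 hV z hz
    exact ⟨ε / 3, by positivity, by rwa [mul_div_cancel₀ _ (by norm_num)]⟩
  refine DifferentiableAt.differentiableWithinAt ?_
  refine (hasDerivAt_integral_of_dominated_loc_of_deriv_le (F' := fun w x => deriv (fun z => F z x) w)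
    (bound := fun x => g x / δ) (Metric.ball_mem_nhds z hδ) ?_ ?_ ?_ ?_ (hg.div_const δ)
    ?_).2.differentiableAt
  · filter_upwards [hV.mem_nhds hz] with w hw using hm w hw
  · refine hg.mono' (hm z hz) ?_
    filter_upwards [hb] with x hx using hx z hz
  -- The derivative at `z` is measurable in `x` as the limit of difference quotients along a
  -- sequence tending to `z`.
  · set u : ℕ → ℂ := fun k => z + ((δ / (k + 1) : ℝ) : ℂ) with hu
    have huV : ∀ k, u k ∈ V := fun k => hδV (by
      have h1 : δ / ((k : ℝ) + 1) ≤ δ := div_le_self hδ.le (by linarith [k.cast_nonneg (α := ℝ)])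
      have h2 : 0 < δ / ((k : ℝ) + 1) := by positivity
      rw [Metric.mem_ball, dist_eq_norm, hu, add_sub_cancel_left, Complex.norm_real,
        Real.norm_of_nonneg h2.le]
      linarith)
    have hu_lim : Tendsto u atTop (𝓝[≠] z) := by
      refine tendsto_nhdsWithin_iff.2 ⟨?_, Eventually.of_forall fun k => ?_⟩
      · have h1 : Tendsto (fun k : ℕ => δ / ((k : ℝ) + 1)) atTop (𝓝 0) :=
          tendsto_const_nhds.div_atTop (tendsto_natCast_atTop_atTop.atTop_add tendsto_const_nhds)
        have h2 := (Complex.continuous_ofReal.tendsto 0).comp h1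
        simpa [hu] using h2.const_add z
      · have h2 : δ / ((k : ℝ) + 1) ≠ 0 := by positivity
        rw [hu, mem_compl_singleton_iff, Ne, add_eq_left, Complex.ofReal_eq_zero]
        exact h2
    refine aestronglyMeasurable_of_tendsto_ae atTop
      (f := fun k x => slope (fun z => F z x) z (u k)) (fun k => ?_) ?_
    · simp only [slope_def_field, div_eq_mul_inv]
      exact ((hm _ (huV k)).sub (hm z hz)).mul aestronglyMeasurable_const
    · filter_upwards [hd] with x hx
      exact ((hx.differentiableAt (hV.mem_nhds hz)).hasDerivAt.tendsto_slope).comp hu_lim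
  · filter_upwards [hb, hd] with x hx hdx w hw
    have hsub : Metric.closedBall w δ ⊆ V := fun v hv => hδV (by
      rw [Metric.mem_ball] at hw ⊢
      rw [Metric.mem_closedBall] at hv
      linarith [dist_triangle v w z])
    refine Complex.norm_deriv_le_of_forall_mem_sphere_norm_le hδ ?_
      fun v hv => hx v (hsub (Metric.sphere_subset_closedBall hv))
    refine (hdx.mono ?_).diffContOnCl
    rwa [closure_ball w hδ.ne']
  · filter_upwards [hd] with x hx w hw
    refine (hx.differentiableAt (hV.mem_nhds (hδV ?_))).hasDerivAt
    rw [Metric.mem_ball] at hw ⊢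
    linarith

/-- `F z x` is holomorphic in `z ∈ V` for every `x ∈ K`, uniformly bounded on `V × K`, and
measurable in `x`. -/
structure BoundedHolomorphic {X : Type*} [MeasurableSpace X] (μ : Measure X) (V : Set ℂ) (K : Set X)
    (F : ℂ → X → ℂ) : Prop where
  meas : ∀ z ∈ V, AEStronglyMeasurable (F z) (μ.restrict K)
  diff : ∀ x ∈ K, DifferentiableOn ℂ (fun z => F z x) V
  bdd : ∃ C, ∀ z ∈ V, ∀ x ∈ K, ‖F z x‖ ≤ C

namespace BoundedHolomorphic

variable {X Y : Type*} [MeasurableSpace X] [MeasurableSpace Y] {μ : Measure X} {ν : Measure Y}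
  {V : Set ℂ} {K : Set X} {F G : ℂ → X → ℂ}

theorem add (hF : BoundedHolomorphic μ V K F) (hG : BoundedHolomorphic μ V K G) :
    BoundedHolomorphic μ V K (fun z x => F z x + G z x) := by
  obtain ⟨C, hC⟩ := hF.bdd
  obtain ⟨D, hD⟩ := hG.bdd
  exact ⟨fun z hz => (hF.meas z hz).add (hG.meas z hz), fun x hx => (hF.diff x hx).add (hG.diff x hx),
    C + D, fun z hz x hx => (norm_add_le _ _).trans (add_le_add (hC z hz x hx) (hD z hz x hx))⟩

theorem sum {ι : Type*} (t : Finset ι) {F : ι → ℂ → X → ℂ}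
    (h : ∀ i ∈ t, BoundedHolomorphic μ V K (F i)) :
    BoundedHolomorphic μ V K (fun z x => ∑ i ∈ t, F i z x) := by
  classical
  induction t using Finset.induction_on with
  | empty =>
    simp only [Finset.sum_empty]
    exact ⟨fun _ _ => aestronglyMeasurable_const, fun _ _ => differentiableOn_const _, 0, by simp⟩
  | insert i t hi ih =>
    simp only [Finset.sum_insert hi]
    exact (h i (by simp)).add (ih fun j hj => h j (by simp [hj]))

theorem integrableOn (hF : BoundedHolomorphic μ V K F) (hK : MeasurableSet K) (hμ : μ K ≠ ⊤)
    {z : ℂ} (hz : z ∈ V) : IntegrableOn (F z) K μ := by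
  obtain ⟨C, hC⟩ := hF.bdd
  refine (integrableOn_const (C := C) hμ).mono' (hF.meas z hz) ?_
  filter_upwards [ae_restrict_mem hK] with x hx using hC z hz x hx

theorem differentiableOn_setIntegral (hF : BoundedHolomorphic μ V K F) (hV : IsOpen V)
    (hK : MeasurableSet K) (hμ : μ K ≠ ⊤) :
    DifferentiableOn ℂ (fun z => ∫ x in K, F z x ∂μ) V := by
  obtain ⟨C, hC⟩ := hF.bdd
  refine differentiableOn_integral_of_dominated hV (g := fun _ => C) hF.meas ?_ ?_
    (integrableOn_const hμ)
  · filter_upwards [ae_restrict_mem hK] with x hx using hF.diff x hx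
  · filter_upwards [ae_restrict_mem hK] with x hx z hz using hC z hz x hx

/-- Integration over the fibre stays in the class, so its result can be integrated again over `K`.
The bound `g` does not depend on `x`, which gives uniform boundedness. -/
theorem integral [SFinite μ] [SFinite ν] {H : ℂ → X × Y → ℂ} {g : Y → ℝ} (hV : IsOpen V)
    (hm : ∀ z ∈ V, AEStronglyMeasurable (H z) ((μ.restrict K).prod ν))
    (hm' : ∀ z ∈ V, ∀ x ∈ K, AEStronglyMeasurable (fun y => H z (x, y)) ν)
    (hd : ∀ x ∈ K, ∀ᵐ y ∂ν, DifferentiableOn ℂ (fun z => H z (x, y)) V)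
    (hb : ∀ x ∈ K, ∀ᵐ y ∂ν, ∀ z ∈ V, ‖H z (x, y)‖ ≤ g y) (hg : Integrable g ν) :
    BoundedHolomorphic μ V K (fun z x => ∫ y, H z (x, y) ∂ν) where
  meas z hz := (hm z hz).integral_prod_right'
  diff x hx := differentiableOn_integral_of_dominated hV (fun z hz => hm' z hz x hx) (hd x hx)
    (hb x hx) hg
  bdd := ⟨∫ y, g y ∂ν, fun z hz x hx => norm_integral_le_of_norm_le hg <| by
    filter_upwards [hb x hx] with y hy using hy z hz⟩

end BoundedHolomorphic

/-! ### Polar coordinates and the radial integral. -/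

theorem integral_volumeIoiPow_indicator (k : ℕ) {r : ℝ} (hr : 1 ≤ r) (h : ℝ → ℂ) :
    ∫ s : Ioi (0 : ℝ), (Ico 1 r).indicator h s ∂Measure.volumeIoiPow k
      = ∫ s in (1 : ℝ)..r, (s : ℂ) ^ k * h s := by
  simp only [Measure.volumeIoiPow, ENNReal.ofReal]
  rw [integral_withDensity_eq_integral_smul
    (f := fun s : Ioi (0 : ℝ) => Real.toNNReal ((s : ℝ) ^ k))
    (measurable_subtype_coe.pow_const _).real_toNNReal,
    integral_subtype_comap measurableSet_Ioi
      fun a => Real.toNNReal (a ^ k) • (Ico 1 r).indicator h a,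
    intervalIntegral.integral_of_le hr, ← integral_Ico_eq_integral_Ioc,
    ← integral_indicator measurableSet_Ioi, ← integral_indicator measurableSet_Ico]
  congr 1
  ext a
  by_cases ha : a ∈ Ico 1 r
  · have ha0 : (0 : ℝ) < a := lt_of_lt_of_le one_pos ha.1
    rw [indicator_of_mem (mem_Ioi.2 ha0), indicator_of_mem ha, indicator_of_mem ha, NNReal.smul_def,
      Real.coe_toNNReal _ (pow_nonneg ha0.le _), Complex.real_smul, Complex.ofReal_pow]
  · rw [indicator_of_notMem ha]
    simp [indicator_of_notMem ha]

theorem setIntegral_annulus_of_homogeneous {n : ℕ} {f : Eucl n → ℂ} {d : ℂ}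
    (hf : ∀ ξ : Eucl n, ξ ≠ 0 → ∀ t : ℝ, 0 < t → f (t • ξ) = (t : ℂ) ^ d * f ξ) {r : ℝ}
    (hr : 1 ≤ r) :
    ∫ ξ in Metric.ball (0 : Eucl n) r \ Metric.ball 0 1, f ξ
      = (∫ ξ : Metric.sphere (0 : Eucl n) 1, f ξ ∂(volume : Measure (Eucl n)).toSphere)
        * ∫ s in (1 : ℝ)..r, (s : ℂ) ^ (d + n - 1) := by
  have hSm : MeasurableSet (Metric.ball (0 : Eucl n) r \ Metric.ball 0 1) :=
    measurableSet_ball.diff measurableSet_ball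
  rcases Nat.eq_zero_or_pos n with rfl | hn
  -- In dimension 0 both the annulus and the unit sphere are empty; polar coordinates need a
  -- nontrivial space.
  · have h1 : Metric.ball (0 : Eucl 0) r \ Metric.ball 0 1 = ∅ := by
      ext ξ
      simp [Subsingleton.elim ξ 0]
    have h2 : IsEmpty (Metric.sphere (0 : Eucl 0) 1) :=
      ⟨fun ξ => by simpa [Subsingleton.elim (ξ : Eucl 0) 0] using ξ.2⟩
    rw [h1, Measure.restrict_empty, integral_zero_measure,
      integral_of_isEmpty (μ := (volume : Measure (Eucl 0)).toSphere), zero_mul]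
  have : Nonempty (Fin n) := ⟨⟨0, hn⟩⟩
  have : Nontrivial (Eucl n) := by
    rw [← Module.finrank_pos_iff (R := ℝ)]
    simpa using hn
  set S := Metric.ball (0 : Eucl n) r \ Metric.ball 0 1 with hS
  set g : Metric.sphere (0 : Eucl n) 1 × Ioi (0 : ℝ) → ℂ :=
    fun p => f p.1 * (Ico 1 r).indicator (fun s : ℝ => (s : ℂ) ^ d) p.2 with hg
  have key : ∀ ξ : ({0}ᶜ : Set (Eucl n)), S.indicator f ξ = g (homeomorphUnitSphereProd _ ξ) := by
    rintro ⟨ξ, hξ⟩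
    have hξ0 : ξ ≠ 0 := hξ
    have hξn : 0 < ‖ξ‖ := norm_pos_iff.2 hξ0
    have hmem : ξ ∈ S ↔ ‖ξ‖ ∈ Ico 1 r := by
      simp [hS, and_comm]
    simp only [hg, homeomorphUnitSphereProd_apply_snd_coe, homeomorphUnitSphereProd_apply_fst_coe]
    by_cases h : ξ ∈ S
    · rw [indicator_of_mem h, indicator_of_mem (hmem.1 h), mul_comm,
        ← hf _ (smul_ne_zero (inv_ne_zero hξn.ne') hξ0) _ hξn, smul_smul,
        mul_inv_cancel₀ hξn.ne', one_smul]
    · rw [indicator_of_notMem h, indicator_of_notMem (fun e => h (hmem.2 e)), mul_zero]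
  calc ∫ ξ in S, f ξ = ∫ ξ, S.indicator f ξ := (integral_indicator hSm).symm
    _ = ∫ ξ in ({0}ᶜ : Set (Eucl n)), S.indicator f ξ := by rw [restrict_compl_singleton]
    _ = ∫ ξ : ({0}ᶜ : Set (Eucl n)), S.indicator f ξ ∂(volume : Measure (Eucl n)).comap (↑) :=
      (integral_subtype_comap (measurableSet_singleton _).compl _).symm
    _ = ∫ ξ : ({0}ᶜ : Set (Eucl n)), g (homeomorphUnitSphereProd _ ξ)
          ∂(volume : Measure (Eucl n)).comap (↑) := by simp only [key]
    _ = ∫ p, g p ∂(volume : Measure (Eucl n)).toSphere.prod (.volumeIoiPow (n - 1)) := by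
      have := (volume : Measure (Eucl n)).measurePreserving_homeomorphUnitSphereProd.integral_comp
        (Homeomorph.measurableEmbedding _) g
      rwa [finrank_euclideanSpace, Fintype.card_fin] at this
    _ = _ := by
      rw [hg, integral_prod_mul (fun ξ : Metric.sphere (0 : Eucl n) 1 => f ξ)
        (fun s : Ioi (0 : ℝ) => (Ico 1 r).indicator (fun s : ℝ => (s : ℂ) ^ d) s),
        integral_volumeIoiPow_indicator _ hr]
      congr 1
      refine intervalIntegral.integral_congr fun s hs => ?_
      rw [uIcc_of_le hr] at hs
      have hs0 : (s : ℂ) ≠ 0 := by exact_mod_cast (lt_of_lt_of_le one_pos hs.1).ne'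
      rw [← Complex.cpow_natCast, ← Complex.cpow_add _ _ hs0, Nat.cast_pred hn]
      congr 1
      ring

namespace SymbolForms

/-- The integral is `(r^w - 1) / w` for `w ≠ 0` and `log r` for `w = 0`. In the second case the
constant term is 0, which agrees with the convention `0⁻¹ = 0`, so one formula serves at the poles
too. -/
theorem hasFinitePart_integral_cpow (w : ℂ) :
    HasFinitePart (fun r => ∫ s in (1 : ℝ)..r, (s : ℂ) ^ (w - 1)) (-w⁻¹) := by
  rcases eq_or_ne w 0 with rfl | hw
  · rw [inv_zero, neg_zero]
    refine hasFinitePart_log.congr' ?_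
    filter_upwards [eventually_ge_atTop 1] with r hr
    have h0 : (0 : ℝ) ∉ uIcc 1 r := by
      rw [uIcc_of_le hr]
      exact fun h => absurd h.1 (by norm_num)
    have h1 : ∀ s : ℝ, (s : ℂ) ^ ((0 : ℂ) - 1) = ((s⁻¹ : ℝ) : ℂ) := fun s => by
      rw [zero_sub, Complex.cpow_neg_one, Complex.ofReal_inv]
    simp only [h1]
    rw [intervalIntegral.integral_ofReal, integral_inv h0, div_one]
  · have h := ((hasFinitePart_cpow hw).const_mul w⁻¹).add
      (HasFinitePart.of_tendsto (tendsto_const_nhds (x := -w⁻¹) (f := (atTop : Filter ℝ))))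
    rw [mul_zero, zero_add] at h
    refine h.congr' ?_
    filter_upwards [eventually_ge_atTop 1] with r hr
    have h0 : (0 : ℝ) ∉ uIcc 1 r := by
      rw [uIcc_of_le hr]
      exact fun h => absurd h.1 (by norm_num)
    rw [integral_cpow (Or.inr ⟨fun e => hw (by linear_combination e), h0⟩)]
    simp only [sub_add_cancel, Complex.ofReal_one, Complex.one_cpow]
    field_simp
    ring

end SymbolForms

/-! ### Homogeneous components of a classical symbol and their uniqueness. -/

namespace SymbolForms

variable {n : ℕ} {U : Set (Eucl n)}

theorem excision_of_norm_le {ξ : Eucl n} (h : ‖ξ‖ ≤ 1 / 2) : excision ξ = 0 :=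
  Real.smoothTransition.zero_of_nonpos (by nlinarith [norm_nonneg ξ])

theorem excision_of_one_le_norm {ξ : Eucl n} (h : 1 ≤ ‖ξ‖) : excision ξ = 1 :=
  Real.smoothTransition.one_of_one_le (by rw [le_div_iff₀ (by norm_num)]; nlinarith)

theorem norm_excision_le (ξ : Eucl n) : ‖(excision ξ : ℂ)‖ ≤ 1 := by
  rw [Complex.norm_real, excision, Real.norm_of_nonneg (Real.smoothTransition.nonneg _)]
  exact Real.smoothTransition.le_one _

theorem mixedPartial_zero (s : Fin 0 → Fin n ⊕ Fin n) (f : Eucl n × Eucl n → ℂ)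
    (p : Eucl n × Eucl n) : mixedPartial s f p = f p := by
  simp [mixedPartial]

theorem fibreCount_zero (s : Fin 0 → Fin n ⊕ Fin n) : fibreCount s = 0 := by
  simp [fibreCount]

theorem IsSymbol.norm_le {m : ℝ} {f : Eucl n × Eucl n → ℂ} (hf : IsSymbol U m f) {K : Set (Eucl n)}
    (hK : IsCompact K) (hKU : K ⊆ U) :
    ∃ C : ℝ, ∀ x ∈ K, ∀ ξ : Eucl n, ‖f (x, ξ)‖ ≤ C * (1 + ‖ξ‖) ^ m := by
  obtain ⟨C, hC⟩ := hf.2 K hK hKU 0 Fin.elim0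
  exact ⟨C, fun x hx ξ => by simpa [mixedPartial_zero, fibreCount_zero] using hC x hx ξ⟩

theorem eq_sum_add_symbolRemainder (σ : Eucl n × Eucl n → ℂ) (a : ℕ → Eucl n × Eucl n → ℂ) (N : ℕ)
    (p : Eucl n × Eucl n) :
    σ p = ∑ j ∈ Finset.range N, (excision p.2 : ℂ) * a j p + symbolRemainder σ a N p := by
  simp [symbolRemainder]

theorem tendsto_cpow_mul_of_isSymbol {f : Eucl n × Eucl n → ℂ} {m : ℝ} (hf : IsSymbol U m f)
    {x ξ : Eucl n} (hx : x ∈ U) (hξ : ξ ≠ 0) {e : ℂ} (hm : m ≤ 0) (hme : m + e.re < 0) :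
    Tendsto (fun t : ℝ => (t : ℂ) ^ e * f (x, t • ξ)) atTop (𝓝 0) := by
  obtain ⟨C, hC⟩ := hf.norm_le isCompact_singleton (singleton_subset_iff.2 hx)
  have hξn : 0 < ‖ξ‖ := norm_pos_iff.2 hξ
  have h1 : Tendsto (fun t : ℝ => |C| * ‖ξ‖ ^ m * t ^ (m + e.re)) atTop (𝓝 0) := by
    have := (tendsto_rpow_neg_atTop (y := -(m + e.re)) (by linarith)).const_mul (|C| * ‖ξ‖ ^ m)
    simpa using this
  refine squeeze_zero_norm' ?_ h1
  filter_upwards [eventually_gt_atTop 0] with t ht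
  have h2 : (1 + ‖t • ξ‖) ^ m ≤ t ^ m * ‖ξ‖ ^ m := by
    rw [← Real.mul_rpow ht.le hξn.le]
    refine Real.rpow_le_rpow_of_nonpos (by positivity) ?_ hm
    rw [norm_smul, Real.norm_of_nonneg ht.le]
    linarith
  calc ‖(t : ℂ) ^ e * f (x, t • ξ)‖ = t ^ e.re * ‖f (x, t • ξ)‖ := by
        rw [norm_mul, Complex.norm_cpow_eq_rpow_re_of_pos ht]
    _ ≤ t ^ e.re * (|C| * (t ^ m * ‖ξ‖ ^ m)) := by
        gcongr
        refine (hC x rfl (t • ξ)).trans ?_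
        refine (mul_le_mul_of_nonneg_right (le_abs_self C) (by positivity)).trans ?_
        gcongr
    _ = |C| * ‖ξ‖ ^ m * t ^ (m + e.re) := by
        rw [Real.rpow_add ht]
        ring

/-- Along a ray, `χ a_j` is eventually a pure power of `t`, so multiplying by `t^(-d)` makes the
degree `d` term the constant one. The component is thus a finite part computed from `σ` alone,
independent of the expansion. -/
theorem IsClassicalExpansion.hasFinitePart_ray {m : ℂ} {σ : Eucl n × Eucl n → ℂ}
    {a : ℕ → Eucl n × Eucl n → ℂ} (h : IsClassicalExpansion U m σ a) {x ξ : Eucl n} (hx : x ∈ U)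
    (hξ : ξ ≠ 0) (d : ℂ) {N : ℕ} (hN : m.re - N ≤ 0) (hN' : m.re - N < d.re) :
    HasFinitePart (fun t => (t : ℂ) ^ (-d) * σ (x, t • ξ))
      (∑ j ∈ Finset.range N, if m - j = d then a j (x, ξ) else 0) := by
  have hξn : 0 < ‖ξ‖ := norm_pos_iff.2 hξ
  have h1 : ∀ j ∈ Finset.range N, HasFinitePart
      (fun t => a j (x, ξ) * (t : ℂ) ^ (m - j - d)) (if m - j = d then a j (x, ξ) else 0) := by
    intro j _
    split_ifs with hj
    · refine (HasFinitePart.of_tendsto (tendsto_const_nhds (x := a j (x, ξ)))).congr' ?_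
      filter_upwards with t
      rw [hj, sub_self, Complex.cpow_zero, mul_one]
    · simpa using (hasFinitePart_cpow (sub_ne_zero.2 hj)).const_mul (a j (x, ξ))
  have h2 := tendsto_cpow_mul_of_isSymbol (h.remainder N) hx hξ (e := -d) hN
    (by rw [Complex.neg_re]; linarith)
  have h3 := (HasFinitePart.sum _ h1).add (HasFinitePart.of_tendsto h2)
  rw [add_zero] at h3
  refine h3.congr' ?_
  filter_upwards [eventually_ge_atTop (1 / ‖ξ‖), eventually_gt_atTop 0] with t ht ht0
  have hχ : excision (t • ξ) = 1 := excision_of_one_le_norm (by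
    rw [norm_smul, Real.norm_of_nonneg ht0.le]
    rwa [div_le_iff₀ hξn] at ht)
  rw [eq_sum_add_symbolRemainder σ a N (x, t • ξ), mul_add, Finset.mul_sum]
  congr 1
  refine Finset.sum_congr rfl fun j _ => ?_
  have ht' : (t : ℂ) ≠ 0 := by exact_mod_cast ht0.ne'
  rw [hχ, h.homogeneous j x hx ξ hξ t ht0, Complex.ofReal_one, one_mul, sub_eq_add_neg _ d,
    Complex.cpow_add _ _ ht']
  ring

theorem IsComponent.hasFinitePart_ray {σ b : Eucl n × Eucl n → ℂ} {d : ℂ}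
    (h : IsComponent U σ d b) {x ξ : Eucl n} (hx : x ∈ U) (hξ : ξ ≠ 0) :
    HasFinitePart (fun t => (t : ℂ) ^ (-d) * σ (x, t • ξ)) (b (x, ξ)) := by
  obtain ⟨m, a, j, ha, hj, rfl⟩ := h
  obtain ⟨N, hN⟩ := exists_nat_gt (max m.re (max (m.re - d.re) j))
  simp only [max_lt_iff, Nat.cast_lt] at hN
  convert ha.hasFinitePart_ray hx hξ d (N := N) (by linarith) (by linarith) using 1
  rw [Finset.sum_eq_single j]
  · rw [if_pos hj]
  · intro i _ hi
    rw [if_neg]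
    intro e
    exact hi (by exact_mod_cast (show (i : ℂ) = j by linear_combination hj - e))
  · intro e
    exact absurd (Finset.mem_range.2 hN.2.2) e

theorem component_eq_zero_of_not_exists {σ : Eucl n × Eucl n → ℂ} {d : ℂ}
    (h : ¬ ∃ b, IsComponent U σ d b) : component U σ d = 0 :=
  dif_neg h

theorem IsClassicalExpansion.component_eq {m : ℂ} {σ : Eucl n × Eucl n → ℂ}
    {a : ℕ → Eucl n × Eucl n → ℂ} (h : IsClassicalExpansion U m σ a) {x ξ : Eucl n} (hx : x ∈ U)
    (hξ : ξ ≠ 0) (d : ℂ) {N : ℕ} (hN : m.re - N ≤ 0) (hN' : m.re - N < d.re) :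
    component U σ d (x, ξ) = ∑ j ∈ Finset.range N, if m - j = d then a j (x, ξ) else 0 := by
  by_cases hb : ∃ b, IsComponent U σ d b
  · rw [component, dif_pos hb]
    exact (hb.choose_spec.hasFinitePart_ray hx hξ).unique (h.hasFinitePart_ray hx hξ d hN hN')
  · rw [component_eq_zero_of_not_exists hb]
    symm
    refine Finset.sum_eq_zero fun j _ => if_neg fun e => hb ⟨a j, m, a, j, h, e, rfl⟩

theorem component_eq_zero {σ : Eucl n × Eucl n → ℂ} {x ξ : Eucl n} (hx : x ∈ U)
    (hξ : ξ ≠ 0) (d : ℂ) (hσ : ∀ ξ, σ (x, ξ) = 0) : component U σ d (x, ξ) = 0 := by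
  by_cases hb : ∃ b, IsComponent U σ d b
  · rw [component, dif_pos hb]
    refine (hb.choose_spec.hasFinitePart_ray hx hξ).unique (HasFinitePart.of_tendsto ?_)
    simp [hσ]
  · rw [component_eq_zero_of_not_exists hb]
    rfl

theorem sphere_ne_zero (ξ : Metric.sphere (0 : Eucl n) 1) : (ξ : Eucl n) ≠ 0 :=
  Metric.ne_of_mem_sphere ξ.2 one_ne_zero

end SymbolForms

/-! ### Parameter integrals with continuous integrands. -/

theorem ContinuousOn.aestronglyMeasurable_restrict_prod {X Y : Type*} [TopologicalSpace X]
    [MeasurableSpace X] [OpensMeasurableSpace X] [SecondCountableTopology X] [TopologicalSpace Y]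
    [MeasurableSpace Y] [OpensMeasurableSpace Y] [SecondCountableTopology Y] {μ : Measure X}
    {ν : Measure Y} [SFinite μ] [SFinite ν] {K : Set X} {H : X × Y → ℂ}
    (hH : ContinuousOn H (K ×ˢ univ)) (hK : MeasurableSet K) :
    AEStronglyMeasurable H ((μ.restrict K).prod ν) := by
  have := hH.aestronglyMeasurable (μ := μ.prod ν) (hK.prod MeasurableSet.univ)
  rwa [← Measure.prod_restrict, Measure.restrict_univ] at this

theorem ContinuousOn.continuous_slice {X Y Z : Type*} [TopologicalSpace X] [TopologicalSpace Y]
    [TopologicalSpace Z] {s : Set X} {f : X × Y → Z} (hf : ContinuousOn f (s ×ˢ univ)) {x : X}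
    (hx : x ∈ s) : Continuous fun y => f (x, y) :=
  hf.comp_continuous (by fun_prop) fun _ => ⟨hx, mem_univ _⟩

theorem BoundedHolomorphic.integral_of_continuousOn {X Y : Type*} [TopologicalSpace X]
    [MeasurableSpace X] [OpensMeasurableSpace X] [SecondCountableTopology X] [TopologicalSpace Y]
    [MeasurableSpace Y] [OpensMeasurableSpace Y] [SecondCountableTopology Y] {μ : Measure X}
    {ν : Measure Y} [SFinite μ] [SFinite ν] {V : Set ℂ} {K : Set X} {H : ℂ → X × Y → ℂ} {g : Y → ℝ}
    (hV : IsOpen V) (hK : MeasurableSet K) (hc : ∀ z ∈ V, ContinuousOn (H z) (K ×ˢ univ))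
    (hd : ∀ x ∈ K, ∀ y, DifferentiableOn ℂ (fun z => H z (x, y)) V)
    (hb : ∀ x ∈ K, ∀ᵐ y ∂ν, ∀ z ∈ V, ‖H z (x, y)‖ ≤ g y) (hg : Integrable g ν) :
    BoundedHolomorphic μ V K (fun z x => ∫ y, H z (x, y) ∂ν) :=
  .integral hV (fun z hz => (hc z hz).aestronglyMeasurable_restrict_prod hK)
    (fun z hz _ hx => ((hc z hz).continuous_slice hx).aestronglyMeasurable)
    (fun x hx => Eventually.of_forall (hd x hx)) hb hg

/-! ### Cut-off integral and residue density of a single symbol. -/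

namespace SymbolForms

variable {n : ℕ} {U : Set (Eucl n)}

/-- The integral of `b(x, ·)` over the unit sphere. -/
noncomputable def sphereIntegral (b : Eucl n × Eucl n → ℂ) (x : Eucl n) : ℂ :=
  ∫ ξ : Metric.sphere (0 : Eucl n) 1, b (x, (ξ : Eucl n)) ∂(volume : Measure (Eucl n)).toSphere

namespace IsClassicalExpansion

variable {m : ℂ} {σ : Eucl n × Eucl n → ℂ} {a : ℕ → Eucl n × Eucl n → ℂ}

theorem continuousOn_symbolRemainder (h : IsClassicalExpansion U m σ a) (N : ℕ) :
    ContinuousOn (symbolRemainder σ a N) (U ×ˢ univ) :=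
  (h.remainder N).1.continuousOn

theorem continuousOn_excision_mul (h : IsClassicalExpansion U m σ a) (j : ℕ) :
    ContinuousOn (fun p : Eucl n × Eucl n => (excision p.2 : ℂ) * a j p) (U ×ˢ univ) := by
  -- Consecutive remainders differ by `χ a_j`, so continuity across `ξ = 0` comes for free.
  refine ((h.continuousOn_symbolRemainder j).sub (h.continuousOn_symbolRemainder (j + 1))).congr
    fun p _ => ?_
  simp only [symbolRemainder, Finset.sum_range_succ, Pi.sub_apply]
  ring

theorem hasFinitePart_ballIntegral_component {w : ℂ} (h : IsClassicalExpansion U (w - n) σ a)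
    {x : Eucl n} (hx : x ∈ U) (j : ℕ) :
    HasFinitePart (fun r => ∫ ξ in Metric.ball (0 : Eucl n) r, (excision ξ : ℂ) * a j (x, ξ))
      ((∫ ξ in Metric.ball (0 : Eucl n) 1, (excision ξ : ℂ) * a j (x, ξ))
        - (w - j)⁻¹ * sphereIntegral (a j) x) := by
  have hc : Continuous fun ξ : Eucl n => (excision ξ : ℂ) * a j (x, ξ) :=
    (h.continuousOn_excision_mul j).continuous_slice hx
  have hi : ∀ r, IntegrableOn (fun ξ : Eucl n => (excision ξ : ℂ) * a j (x, ξ))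
      (Metric.ball (0 : Eucl n) r) := fun r =>
    (hc.continuousOn.integrableOn_compact (isCompact_closedBall 0 r)).mono_set
      Metric.ball_subset_closedBall
  have h1 := (HasFinitePart.of_tendsto (tendsto_const_nhds (f := (atTop : Filter ℝ))
    (x := ∫ ξ in Metric.ball (0 : Eucl n) 1, (excision ξ : ℂ) * a j (x, ξ)))).add
    ((hasFinitePart_integral_cpow (w - j)).const_mul (sphereIntegral (a j) x))
  have e : (∫ ξ in Metric.ball (0 : Eucl n) 1, (excision ξ : ℂ) * a j (x, ξ))
      - (w - j)⁻¹ * sphereIntegral (a j) x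
      = (∫ ξ in Metric.ball (0 : Eucl n) 1, (excision ξ : ℂ) * a j (x, ξ))
        + sphereIntegral (a j) x * -(w - j)⁻¹ := by ring
  rw [e]
  refine h1.congr' ?_
  filter_upwards [eventually_ge_atTop 1] with r hr
  -- The ball of radius `r` is the unit ball together with an annulus, and `χ = 1` on the annulus.
  have h2 : ∫ ξ in Metric.ball (0 : Eucl n) r \ Metric.ball 0 1, (excision ξ : ℂ) * a j (x, ξ)
      = ∫ ξ in Metric.ball (0 : Eucl n) r \ Metric.ball 0 1, a j (x, ξ) := by
    refine setIntegral_congr_fun (measurableSet_ball.diff measurableSet_ball) fun ξ hξ => ?_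
    have : 1 ≤ ‖ξ‖ := by simpa using hξ.2
    simp [excision_of_one_le_norm this]
  have h3 := setIntegral_annulus_of_homogeneous (f := fun ξ => a j (x, ξ))
    (fun ξ hξ t ht => h.homogeneous j x hx ξ hξ t ht) hr
  have e2 : w - n - j + n - 1 = w - j - 1 := by ring
  rw [e2] at h3
  rw [sphereIntegral, ← h3, ← h2, ← setIntegral_union disjoint_sdiff_right
    (measurableSet_ball.diff measurableSet_ball) (hi 1) ((hi r).mono_set sdiff_subset),
    union_sdiff_cancel (Metric.ball_subset_ball hr)]

theorem integrable_symbolRemainder {w : ℂ} (h : IsClassicalExpansion U (w - n) σ a)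
    {x : Eucl n} (hx : x ∈ U) {N : ℕ} (hN : w.re < N) :
    Integrable fun ξ => symbolRemainder σ a N (x, ξ) := by
  obtain ⟨C, hC⟩ := (h.remainder N).norm_le isCompact_singleton (singleton_subset_iff.2 hx)
  have h1 : Integrable fun ξ : Eucl n => (1 + ‖ξ‖) ^ (-((n : ℝ) + N - w.re)) :=
    integrable_one_add_norm (by rw [finrank_euclideanSpace, Fintype.card_fin]; linarith)
  refine (h1.const_mul C).mono'
    ((h.continuousOn_symbolRemainder N).continuous_slice hx).aestronglyMeasurable ?_
  filter_upwards with ξ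
  convert hC x rfl ξ using 3
  simp
  ring

theorem hasFinitePart_ballIntegral {w : ℂ} (h : IsClassicalExpansion U (w - n) σ a)
    {x : Eucl n} (hx : x ∈ U) {N : ℕ} (hN : w.re < N) :
    HasFinitePart (ballIntegral σ x)
      ((∑ j ∈ Finset.range N, ∫ ξ in Metric.ball (0 : Eucl n) 1, (excision ξ : ℂ) * a j (x, ξ))
        + (∫ ξ, symbolRemainder σ a N (x, ξ))
        - ∑ j ∈ Finset.range N, (w - j)⁻¹ * sphereIntegral (a j) x) := by
  have hr := h.integrable_symbolRemainder hx hN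
  have h1 := (HasFinitePart.sum (Finset.range N) fun j _ =>
    h.hasFinitePart_ballIntegral_component hx j).add (HasFinitePart.of_tendsto
      ((aecover_ball (x := (0 : Eucl n)) tendsto_id).integral_tendsto_of_countably_generated hr))
  rw [Finset.sum_sub_distrib, sub_add_eq_add_sub] at h1
  refine h1.congr' (Eventually.of_forall fun r => ?_)
  have hi : ∀ j ∈ Finset.range N, IntegrableOn
      (fun ξ : Eucl n => (excision ξ : ℂ) * a j (x, ξ)) (Metric.ball (0 : Eucl n) r) := fun j _ =>
    ((((h.continuousOn_excision_mul j).continuous_slice hx).continuousOn.integrableOn_compact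
      (isCompact_closedBall 0 r)).mono_set Metric.ball_subset_closedBall)
  simp only [ballIntegral, id]
  rw [← integral_finsetSum _ hi, ← integral_add (integrable_finsetSum _ hi) hr.integrableOn]
  simp only [← eq_sum_add_symbolRemainder σ a N (x, _)]

/-- The term `a_j` has degree `w - n - j`, which equals `-n` exactly when `j = w`; such a `j` is
below `N` because `Re w < N`. -/
theorem residueDensity_eq {w : ℂ} (h : IsClassicalExpansion U (w - n) σ a)
    {x : Eucl n} (hx : x ∈ U) {N : ℕ} (hN : w.re < N) :
    residueDensity U σ x
      = ∑ j ∈ Finset.range N, if w = j then sphereIntegral (a j) x else 0 := by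
  have hcomp : ∀ ξ : Metric.sphere (0 : Eucl n) 1, component U σ (-(n : ℂ)) (x, (ξ : Eucl n))
      = ∑ j ∈ Finset.range N, if w = j then a j (x, (ξ : Eucl n)) else 0 := fun ξ => by
    obtain ⟨M, hM⟩ := exists_nat_gt (max (N : ℝ) w.re)
    rw [max_lt_iff, Nat.cast_lt] at hM
    rw [h.component_eq hx (sphere_ne_zero ξ) (-(n : ℂ)) (N := M)
      (by simp; linarith [n.cast_nonneg (α := ℝ)]) (by simp; linarith)]
    have e : ∀ j : ℕ, w - n - j = -n ↔ w = j := fun j =>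
      ⟨fun e => by linear_combination e, fun e => by rw [e]; ring⟩
    simp only [e]
    symm
    refine Finset.sum_subset (Finset.range_mono hM.1.le) fun j _ hj => if_neg fun e => ?_
    rw [e, Complex.natCast_re, Nat.cast_lt] at hN
    exact hj (Finset.mem_range.2 hN)
  simp only [residueDensity, hcomp]
  by_cases hw : ∃ k : ℕ, w = k
  · obtain ⟨k, rfl⟩ := hw
    have hk : k ∈ Finset.range N := Finset.mem_range.2 (by simpa using hN)
    simp only [Nat.cast_inj, Finset.sum_ite_eq, if_pos hk, sphereIntegral]
  · push Not at hw
    simp [hw]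

end IsClassicalExpansion

end SymbolForms

/-! ### The local formula for a holomorphic family. -/

namespace SymbolForms

variable {n : ℕ} {U : Set (Eucl n)}

/-- Compactness of the shell away from `ξ = 0`. The shell contains the unit sphere and the part of
the unit ball where `χ` may be nonzero. -/
theorem IsHolomorphicSmooth.exists_bound_on_shell {W : Set ℂ} {b : ℂ → Eucl n × Eucl n → ℂ}
    (hb : IsHolomorphicSmooth W (U ×ˢ {0}ᶜ) b) {L : Set ℂ} (hL : IsCompact L) (hLW : L ⊆ W)
    {K : Set (Eucl n)} (hK : IsCompact K) (hKU : K ⊆ U) :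
    ∃ C : ℝ, ∀ z ∈ L, ∀ x ∈ K, ∀ ξ : Eucl n, 1 / 2 ≤ ‖ξ‖ → ‖ξ‖ ≤ 1 → ‖b z (x, ξ)‖ ≤ C := by
  have hs : IsCompact {ξ : Eucl n | 1 / 2 ≤ ‖ξ‖ ∧ ‖ξ‖ ≤ 1} := by
    refine (isCompact_closedBall (0 : Eucl n) 1).of_isClosed_subset ?_ fun ξ hξ => by
      simpa using hξ.2
    exact (isClosed_le continuous_const continuous_norm).inter
      (isClosed_le continuous_norm continuous_const)
  obtain ⟨C, hC⟩ := (hL.prod (hK.prod hs)).exists_bound_of_continuousOn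
    (hb.1.continuousOn.mono (prod_mono hLW (prod_mono hKU fun ξ hξ => by
      intro h0
      rw [mem_singleton_iff] at h0
      have := hξ.1
      rw [h0, norm_zero] at this
      norm_num at this)))
  exact ⟨C, fun z hz x hx ξ h1 h2 => hC (z, x, ξ) ⟨hz, hx, h1, h2⟩⟩

theorem boundedHolomorphic_sphereIntegral {W : Set ℂ} {b : ℂ → Eucl n × Eucl n → ℂ}
    (hb : IsHolomorphicSmooth W (U ×ˢ {0}ᶜ) b) {V L : Set ℂ} (hV : IsOpen V) (hVL : V ⊆ L)
    (hL : IsCompact L) (hLW : L ⊆ W) {K : Set (Eucl n)} (hK : IsCompact K) (hKU : K ⊆ U) :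
    BoundedHolomorphic volume V K (fun z => sphereIntegral (b z)) := by
  obtain ⟨C, hC⟩ := hb.exists_bound_on_shell hL hLW hK hKU
  refine BoundedHolomorphic.integral_of_continuousOn (Y := Metric.sphere (0 : Eucl n) 1)
    (H := fun z p => b z (p.1, (p.2 : Eucl n))) (g := fun _ => C) hV hK.measurableSet
    (fun z hz => ?_) (fun x hx ξ => ?_) (fun x hx => Eventually.of_forall fun ξ z hz => ?_)
    (integrable_const C)
  · refine hb.1.continuousOn.comp
      (f := fun p : Eucl n × Metric.sphere (0 : Eucl n) 1 => (z, p.1, (p.2 : Eucl n)))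
      (by fun_prop) fun p hp => ⟨hLW (hVL hz), hKU hp.1, sphere_ne_zero p.2⟩
  · exact (hb.2 (x, ξ) ⟨hKU hx, sphere_ne_zero ξ⟩).mono (hVL.trans hLW)
  · have h1 : ‖(ξ : Eucl n)‖ = 1 := by simp
    exact hC z (hVL hz) x hx ξ (by rw [h1]; norm_num) h1.le

theorem differentiableOn_excision_mul {W : Set ℂ} {b : ℂ → Eucl n × Eucl n → ℂ}
    (hb : IsHolomorphicSmooth W (U ×ˢ {0}ᶜ) b) {x : Eucl n} (hx : x ∈ U) (ξ : Eucl n) :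
    DifferentiableOn ℂ (fun z => (excision ξ : ℂ) * b z (x, ξ)) W := by
  rcases eq_or_ne ξ 0 with rfl | hξ
  · rw [excision_of_norm_le (by simp)]
    simp
  · exact (hb.2 (x, ξ) ⟨hx, hξ⟩).const_mul _

theorem boundedHolomorphic_excisionIntegral {W : Set ℂ} {b : ℂ → Eucl n × Eucl n → ℂ}
    (hb : IsHolomorphicSmooth W (U ×ˢ {0}ᶜ) b)
    (hc : ∀ z ∈ W, ContinuousOn (fun p : Eucl n × Eucl n => (excision p.2 : ℂ) * b z p) (U ×ˢ univ))
    {V L : Set ℂ} (hV : IsOpen V) (hVL : V ⊆ L)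
    (hL : IsCompact L) (hLW : L ⊆ W) {K : Set (Eucl n)} (hK : IsCompact K) (hKU : K ⊆ U) :
    BoundedHolomorphic volume V K
      (fun z x => ∫ ξ in Metric.ball (0 : Eucl n) 1, (excision ξ : ℂ) * b z (x, ξ)) := by
  obtain ⟨C, hC⟩ := hb.exists_bound_on_shell hL hLW hK hKU
  refine BoundedHolomorphic.integral_of_continuousOn
    (H := fun z p => (excision p.2 : ℂ) * b z p) (g := fun _ => |C|) hV hK.measurableSet
    (fun z hz => (hc z (hLW (hVL hz))).mono (prod_mono hKU subset_rfl))
    (fun x hx ξ => (differentiableOn_excision_mul hb (hKU hx) ξ).mono (hVL.trans hLW))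
    (fun x hx => ?_) (integrableOn_const measure_ball_lt_top.ne)
  filter_upwards [ae_restrict_mem measurableSet_ball] with ξ hξ z hz
  have hξ1 : ‖ξ‖ ≤ 1 := by simpa using (Metric.mem_ball.1 hξ).le
  rcases le_total ‖ξ‖ (1 / 2) with h | h
  · simp [excision_of_norm_le h]
  · rw [norm_mul]
    exact (mul_le_of_le_one_left (norm_nonneg _) (norm_excision_le ξ)).trans
      ((hC z (hVL hz) x hx ξ h hξ1).trans (le_abs_self C))

theorem IsLocallyUniformSymbol.exists_norm_le {W : Set ℂ} {m : ℂ → ℝ}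
    {f : ℂ → Eucl n × Eucl n → ℂ} (hf : IsLocallyUniformSymbol U W m f) {z₀ : ℂ} (hz₀ : z₀ ∈ W)
    {K : Set (Eucl n)} (hK : IsCompact K) (hKU : K ⊆ U) :
    ∃ C : ℝ, ∀ᶠ z in 𝓝 z₀, ∀ x ∈ K, ∀ ξ : Eucl n, ‖f z (x, ξ)‖ ≤ C * (1 + ‖ξ‖) ^ m z := by
  obtain ⟨C, hC⟩ := hf.2 z₀ hz₀ K hK hKU 0 Fin.elim0
  refine ⟨C, ?_⟩
  filter_upwards [hC] with z hz x hx ξ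
  simpa [mixedPartial_zero, fibreCount_zero] using hz x hx ξ

theorem boundedHolomorphic_integral_of_rpow_bound {W : Set ℂ} {f : ℂ → Eucl n × Eucl n → ℂ}
    (hf : IsHolomorphicSmooth W (U ×ˢ univ) f) {V : Set ℂ} (hV : IsOpen V) (hVW : V ⊆ W)
    {K : Set (Eucl n)} (hK : IsCompact K) (hKU : K ⊆ U) {C : ℝ} {m : ℂ → ℝ} {d : ℝ} (hd : n < d)
    (hm : ∀ z ∈ V, m z ≤ -d)
    (hC : ∀ z ∈ V, ∀ x ∈ K, ∀ ξ : Eucl n, ‖f z (x, ξ)‖ ≤ C * (1 + ‖ξ‖) ^ m z) :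
    BoundedHolomorphic volume V K (fun z x => ∫ ξ, f z (x, ξ)) := by
  have hg : Integrable fun ξ : Eucl n => |C| * (1 + ‖ξ‖) ^ (-d) :=
    (integrable_one_add_norm (by rwa [finrank_euclideanSpace, Fintype.card_fin])).const_mul _
  refine BoundedHolomorphic.integral_of_continuousOn hV hK.measurableSet (fun z hz => ?_)
    (fun x hx ξ => (hf.2 (x, ξ) ⟨hKU hx, mem_univ _⟩).mono hVW)
    (fun x hx => Eventually.of_forall fun ξ z hz => ?_) hg
  · exact hf.1.continuousOn.comp (f := fun p : Eucl n × Eucl n => (z, p)) (by fun_prop)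
      fun p hp => ⟨hVW hz, hKU hp.1, mem_univ _⟩
  · refine (hC z hz x hx ξ).trans ?_
    refine (mul_le_mul_of_nonneg_right (le_abs_self C) (by positivity)).trans ?_
    gcongr
    · linarith [norm_nonneg ξ]
    · exact hm z hz

/-- Near `z₀` and over the compact set `K`, the cut-off integral of a holomorphic family of order
`α - n` is a holomorphic function plus a combination of the functions `(α - j)⁻¹` (which vanish by
convention where `α = j`), and the residue density is read off from the same coefficients. -/
theorem HasHolomorphicOrder.exists_local_formula {W : Set ℂ} (hW : IsOpen W) {α : ℂ → ℂ}
    (hα : DifferentiableOn ℂ α W) {σ : ℂ → Eucl n × Eucl n → ℂ}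
    (hσ : HasHolomorphicOrder U W (fun z => α z - n) σ) {z₀ : ℂ} (hz₀ : z₀ ∈ W)
    {K : Set (Eucl n)} (hK : IsCompact K) (hKU : K ⊆ U) :
    ∃ (V : Set ℂ) (N : ℕ) (A : ℂ → Eucl n → ℂ) (S : ℕ → ℂ → Eucl n → ℂ),
      IsOpen V ∧ z₀ ∈ V ∧ V ⊆ W ∧ BoundedHolomorphic volume V K A ∧
      (∀ j, BoundedHolomorphic volume V K (S j)) ∧
      ∀ z ∈ V, ∀ x ∈ K,
        HasFinitePart (ballIntegral (σ z) x)
          (A z x - ∑ j ∈ Finset.range N, (α z - j)⁻¹ * S j z x) ∧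
        residueDensity U (σ z) x = ∑ j ∈ Finset.range N, if α z = j then S j z x else 0 := by
  obtain ⟨-, -, a, ha, hah, hrem⟩ := hσ
  -- Near `z₀`, `Re α` grows by less than 1, and the remainder estimate is used with `ε = 1`. The
  -- margin 3 then leaves the order below `-(n + 1)`, hence integrable on `ℝⁿ`.
  obtain ⟨N, hN⟩ := exists_nat_gt (max 1 ((α z₀).re + 3))
  rw [max_lt_iff] at hN
  have hN1 : 1 ≤ N := by exact_mod_cast hN.1.le
  obtain ⟨hρ, hρ'⟩ := hrem N hN1
  obtain ⟨C, hC⟩ := (hρ' 0 1 one_pos).exists_norm_le hz₀ hK hKU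
  have hre : ∀ᶠ z in 𝓝 z₀, (α z).re < (α z₀).re + 1 :=
    (Complex.continuous_re.continuousAt.comp
      (hα.continuousOn.continuousAt (hW.mem_nhds hz₀))).eventually_lt continuousAt_const
      (by simp)
  have hWe : ∀ᶠ z in 𝓝 z₀, z ∈ W := hW.mem_nhds hz₀
  obtain ⟨r, hr, hrV⟩ := Metric.nhds_basis_closedBall.mem_iff.1 (hWe.and (hC.and hre))
  have hLW : Metric.closedBall z₀ r ⊆ W := fun z hz => (hrV hz).1
  have hL := isCompact_closedBall z₀ r
  have hVL : Metric.ball z₀ r ⊆ Metric.closedBall z₀ r := Metric.ball_subset_closedBall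
  have hV : IsOpen (Metric.ball z₀ r) := Metric.isOpen_ball
  refine ⟨Metric.ball z₀ r, N, _, fun j z => sphereIntegral (a j z), hV, Metric.mem_ball_self hr,
    hVL.trans hLW,
    (BoundedHolomorphic.sum (Finset.range N) fun j _ => boundedHolomorphic_excisionIntegral (hah j)
      (fun z hz => (ha z hz).continuousOn_excision_mul j) hV hVL hL hLW hK hKU).add
      (boundedHolomorphic_integral_of_rpow_bound hρ hV (hVL.trans hLW) hK hKU (C := C)
        (m := fun z => (α z - n).re - N + 1) (d := n + 1) (by linarith) (fun z hz => ?_)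
        fun z hz x hx ξ => ?_),
    fun j => boundedHolomorphic_sphereIntegral (hah j) hV hVL hL hLW hK hKU, fun z hz x hx => ?_⟩
  · have := (hrV (hVL hz)).2.2
    simp only [Complex.sub_re, Complex.natCast_re] at this ⊢
    linarith
  · simpa using (hrV (hVL hz)).2.1 x hx ξ
  · have hzN : (α z).re < N := by
      have := (hrV (hVL hz)).2.2
      linarith
    have hz' := ha z (hLW (hVL hz))
    exact ⟨hz'.hasFinitePart_ballIntegral (hKU hx) hzN, hz'.residueDensity_eq (hKU hx) hzN⟩

end SymbolForms

/-! ### A compact support common to all parameters. -/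

namespace SymbolForms

variable {n : ℕ} {U : Set (Eucl n)}

theorem HasHolomorphicOrder.differentiableOn {W : Set ℂ} {β : ℂ → ℂ}
    {σ : ℂ → Eucl n × Eucl n → ℂ} (hσ : HasHolomorphicOrder U W β σ) {x : Eucl n} (hx : x ∈ U)
    (ξ : Eucl n) : DifferentiableOn ℂ (fun z => σ z (x, ξ)) W := by
  obtain ⟨-, -, a, -, hah, hrem⟩ := hσ
  have h := (differentiableOn_excision_mul (hah 0) hx ξ).add
    ((hrem 1 le_rfl).1.2 (x, ξ) ⟨hx, mem_univ _⟩)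
  refine h.congr fun z _ => ?_
  rw [eq_sum_add_symbolRemainder (σ z) (fun j => a j z) 1 (x, ξ)]
  simp

/-- The symbols of a holomorphic family on a connected domain vanish outside one and the same
compact subset of `U`. -/
theorem HasHolomorphicOrder.exists_common_compact_support {W : Set ℂ} (hU : IsOpen U)
    (hW : IsOpen W) (hWc : IsPreconnected W) (hWne : W.Nonempty) {β : ℂ → ℂ}
    {σ : ℂ → Eucl n × Eucl n → ℂ} (hσ : HasHolomorphicOrder U W β σ) :
    ∃ K : Set (Eucl n), IsCompact K ∧ K ⊆ U ∧ ∀ z ∈ W, ∀ x, x ∉ K → ∀ ξ, σ z (x, ξ) = 0 := by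
  have : LocallyCompactSpace U := hU.locallyCompactSpace
  have : BaireSpace W := hW.baireSpace
  have : Nonempty W := hWne.to_subtype
  set L : CompactExhaustion U := default
  -- `E k` is the set of parameters whose symbol is supported in the `k`-th set of an exhaustion of
  -- `U`. These closed sets cover `W`, so by Baire one has an interior point. The vanishing near
  -- that point spreads over the connected set `W` by the identity theorem.
  set E : ℕ → Set W := fun k => {z | ∀ x : U, x ∉ L k → ∀ ξ, σ z (x, ξ) = 0} with hE
  have hEc : ∀ k, IsClosed (E k) := fun k => by
    simp only [hE, ofPred_forall]
    refine isClosed_iInter fun x => isClosed_iInter fun _ => isClosed_iInter fun ξ => ?_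
    exact isClosed_eq (hσ.differentiableOn x.2 ξ).continuousOn.domRestrict continuous_const
  have hEu : ⋃ k, E k = univ := by
    refine eq_univ_of_forall fun z => ?_
    obtain ⟨K, hK, hKU, hKσ⟩ := hσ.2.1 z z.2
    obtain ⟨k, hk⟩ := L.exists_superset_of_isCompact
      (Topology.IsInducing.subtypeVal.isCompact_preimage_iff
        (by rwa [Subtype.range_coe]) |>.2 hK)
    exact mem_iUnion.2 ⟨k, fun x hx ξ => hKσ x (fun h => hx (hk h)) ξ⟩
  obtain ⟨k, z, hz⟩ := nonempty_interior_of_iUnion_of_closed hEc hEu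
  refine ⟨(↑) '' (L k), (L.isCompact k).image continuous_subtype_val,
    Subtype.coe_image_subset _ _, fun w hw x hx ξ => ?_⟩
  by_cases hxU : x ∈ U
  · have hnear : (fun v => σ v (x, ξ)) =ᶠ[𝓝 (z : ℂ)] fun _ => 0 := by
      have h1 : Subtype.val '' E k ∈ 𝓝 (z : ℂ) := by
        rw [← hW.isOpenEmbedding_subtypeVal.map_nhds_eq]
        exact image_mem_map (mem_interior_iff_mem_nhds.1 hz)
      filter_upwards [h1] with v hv
      obtain ⟨v', hv', rfl⟩ := hv
      exact hv' ⟨x, hxU⟩ (fun h => hx ⟨_, h, rfl⟩) ξ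
    exact AnalyticOnNhd.eqOn_of_preconnected_of_eventuallyEq
      ((hσ.differentiableOn hxU ξ).analyticOnNhd hW) analyticOnNhd_const hWc z.2 hnear hw
  · obtain ⟨K, -, hKU, hKσ⟩ := hσ.2.1 w hw
    exact hKσ x (fun h => hxU (hKU h)) ξ

end SymbolForms

/-! ### Poles of `A - ∑ (α - j)⁻¹ S_j` -/

section Poles

variable {f α A : ℂ → ℂ} {S : ℕ → ℂ → ℂ} {z₀ : ℂ} {N : ℕ}

theorem meromorphicAt_of_eventuallyEq_sub_sum (hα : AnalyticAt ℂ α z₀) (hA : AnalyticAt ℂ A z₀)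
    (hS : ∀ j, AnalyticAt ℂ (S j) z₀)
    (hf : ∀ᶠ z in 𝓝 z₀, f z = A z - ∑ j ∈ Finset.range N, (α z - j)⁻¹ * S j z) :
    MeromorphicAt f z₀ := by
  refine MeromorphicAt.congr (f := fun z => A z - ∑ j ∈ Finset.range N, (α z - j)⁻¹ * S j z) ?_
    ((hf.filter_mono nhdsWithin_le_nhds).mono fun z hz => hz.symm)
  refine hA.meromorphicAt.sub (MeromorphicAt.fun_sum fun j _ => ?_)
  exact ((hα.sub analyticAt_const).meromorphicAt.inv).mul (hS j).meromorphicAt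

theorem analyticAt_of_eventuallyEq_sub_sum (hα : AnalyticAt ℂ α z₀) (hA : AnalyticAt ℂ A z₀)
    (hS : ∀ j, AnalyticAt ℂ (S j) z₀)
    (hf : ∀ᶠ z in 𝓝 z₀, f z = A z - ∑ j ∈ Finset.range N, (α z - j)⁻¹ * S j z)
    (h : ∀ j : ℕ, α z₀ ≠ j) : AnalyticAt ℂ f z₀ := by
  refine AnalyticAt.congr (f := fun z => A z - ∑ j ∈ Finset.range N, (α z - j)⁻¹ * S j z) ?_
    (hf.mono fun z hz => hz.symm)
  refine hA.sub (Finset.analyticAt_fun_sum _ fun j _ => ?_)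
  exact ((hα.sub analyticAt_const).inv (sub_ne_zero.2 (h j))).mul (hS j)

namespace SymbolForms

/-- Off `z₀`, `α - w` is `z - z₀` times the divided difference of `α`, which is analytic with value
`α'(z₀) ≠ 0` at `z₀`. Dividing `T` by it gives `h`; then `h(z₀)` is the residue and the divided
difference of `h` is the regular part. -/
theorem hasSimplePoleWithResidue_inv_sub_mul {w : ℂ} {T : ℂ → ℂ} (hα : AnalyticAt ℂ α z₀)
    (hT : AnalyticAt ℂ T z₀) (hw : α z₀ = w) (hd : deriv α z₀ ≠ 0) :
    HasSimplePoleWithResidue (fun z => (α z - w)⁻¹ * T z) z₀ ((deriv α z₀)⁻¹ * T z₀) := by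
  set h : ℂ → ℂ := fun z => (dslope α z₀ z)⁻¹ * T z with hh
  have hds : AnalyticAt ℂ (dslope α z₀) z₀ := by
    obtain ⟨p, hp⟩ := hα
    exact hp.has_fpower_series_dslope_fslope.analyticAt
  have hha : AnalyticAt ℂ h z₀ := (hds.inv (by rwa [dslope_same])).mul hT
  refine ⟨dslope h z₀, ?_, ?_⟩
  · obtain ⟨p, hp⟩ := hha
    exact hp.has_fpower_series_dslope_fslope.analyticAt
  · filter_upwards [self_mem_nhdsWithin] with z hz
    have hz' : z - z₀ ≠ 0 := sub_ne_zero.2 hz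
    have h0 : h z₀ = (deriv α z₀)⁻¹ * T z₀ := by simp [hh]
    rw [dslope_of_ne _ hz, slope_def_field, ← h0, smul_eq_mul]
    have h1 : h z = (z - z₀) * ((α z - w)⁻¹ * T z) := by
      simp only [hh, dslope_of_ne _ hz, slope_def_field, hw, inv_div]
      ring
    rw [h1]
    field_simp
    ring

theorem HasSimplePoleWithResidue.add {g : ℂ → ℂ} {r s : ℂ} (hf : HasSimplePoleWithResidue f z₀ r)
    (hg : HasSimplePoleWithResidue g z₀ s) :
    HasSimplePoleWithResidue (fun z => f z + g z) z₀ (r + s) := by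
  obtain ⟨u, hu, hu'⟩ := hf
  obtain ⟨v, hv, hv'⟩ := hg
  refine ⟨fun z => u z + v z, hu.add hv, ?_⟩
  filter_upwards [hu', hv'] with z h1 h2
  rw [h1, h2, smul_add]
  ring

theorem HasSimplePoleWithResidue.of_analyticAt (hf : AnalyticAt ℂ f z₀) :
    HasSimplePoleWithResidue f z₀ 0 :=
  ⟨f, hf, by simp⟩

theorem HasSimplePoleWithResidue.sum {ι : Type*} (t : Finset ι) {F : ι → ℂ → ℂ} {r : ι → ℂ}
    (h : ∀ i ∈ t, HasSimplePoleWithResidue (F i) z₀ (r i)) :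
    HasSimplePoleWithResidue (fun z => ∑ i ∈ t, F i z) z₀ (∑ i ∈ t, r i) := by
  classical
  induction t using Finset.induction_on with
  | empty => simpa using HasSimplePoleWithResidue.of_analyticAt analyticAt_const
  | insert i t hi ih =>
    simp only [Finset.sum_insert hi]
    exact (h i (by simp)).add (ih fun j hj => h j (by simp [hj]))

theorem HasSimplePoleWithResidue.neg {r : ℂ} (hf : HasSimplePoleWithResidue f z₀ r) :
    HasSimplePoleWithResidue (fun z => -f z) z₀ (-r) := by
  obtain ⟨u, hu, hu'⟩ := hf
  refine ⟨fun z => -u z, hu.neg, ?_⟩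
  filter_upwards [hu'] with z h1
  rw [h1, smul_neg, neg_add]

theorem hasSimplePoleWithResidue_of_eventuallyEq_sub_sum (hα : AnalyticAt ℂ α z₀)
    (hA : AnalyticAt ℂ A z₀) (hS : ∀ j, AnalyticAt ℂ (S j) z₀)
    (hf : ∀ᶠ z in 𝓝 z₀, f z = A z - ∑ j ∈ Finset.range N, (α z - j)⁻¹ * S j z)
    (hd : deriv α z₀ ≠ 0) :
    HasSimplePoleWithResidue f z₀
      (-(1 / deriv α z₀) * ∑ j ∈ Finset.range N, if α z₀ = j then S j z₀ else 0) := by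
  have h1 : ∀ j ∈ Finset.range N, HasSimplePoleWithResidue (fun z => (α z - j)⁻¹ * S j z) z₀
      ((deriv α z₀)⁻¹ * if α z₀ = j then S j z₀ else 0) := fun j _ => by
    split_ifs with hj
    · exact hasSimplePoleWithResidue_inv_sub_mul hα (hS j) hj hd
    · rw [mul_zero]
      exact .of_analyticAt (((hα.sub analyticAt_const).inv (sub_ne_zero.2 hj)).mul (hS j))
  have h2 := (HasSimplePoleWithResidue.of_analyticAt hA).add (HasSimplePoleWithResidue.sum _ h1).neg
  rw [← Finset.mul_sum, zero_add, ← neg_mul] at h2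
  obtain ⟨g, hg, hg'⟩ := h2
  refine ⟨g, hg, ?_⟩
  filter_upwards [hg', hf.filter_mono nhdsWithin_le_nhds] with z h3 h4
  rw [h4, one_div, ← h3, sub_eq_add_neg]

theorem HasSimplePoleWithResidue.pi {ι : Type*} [Fintype ι] {F : ℂ → ι → ℂ} {r : ι → ℂ}
    (h : ∀ i, HasSimplePoleWithResidue (fun z => F z i) z₀ (r i)) :
    HasSimplePoleWithResidue F z₀ r := by
  choose g hg hg' using h
  refine ⟨fun z i => g i z, AnalyticAt.pi hg, ?_⟩
  filter_upwards [eventually_all.2 hg'] with z hz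
  ext i
  exact hz i

end SymbolForms

/-- A finite family of functions is a sum of scalar functions times basis vectors. -/
theorem MeromorphicAt.pi {ι : Type*} [Fintype ι] {F : ℂ → ι → ℂ}
    (h : ∀ i, MeromorphicAt (fun z => F z i) z₀) : MeromorphicAt F z₀ := by
  classical
  have e : F = fun z => ∑ i, F z i • (Pi.single i 1 : ι → ℂ) := by
    ext z k
    simp [Finset.sum_apply, Pi.single_apply]
  rw [e]
  exact MeromorphicAt.fun_sum fun i _ => (h i).smul (MeromorphicAt.const _ _)

end Poles

/-! ### From the local formula to fibre and total integrals. -/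

namespace SymbolForms

variable {n : ℕ} {U : Set (Eucl n)}

/-- Near `z₀`, `f = A - ∑_{j < N} (α - j)⁻¹ S_j` with `A` and `S_j` holomorphic, and `ρ` is the sum
of the `S_j(z₀)` with `α(z₀) = j`. -/
def HasShiftedInverseExpansion (α f : ℂ → ℂ) (z₀ ρ : ℂ) : Prop :=
  ∃ (N : ℕ) (A : ℂ → ℂ) (S : ℕ → ℂ → ℂ), AnalyticAt ℂ A z₀ ∧ (∀ j, AnalyticAt ℂ (S j) z₀) ∧
    (∀ᶠ z in 𝓝 z₀, f z = A z - ∑ j ∈ Finset.range N, (α z - j)⁻¹ * S j z) ∧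
    ρ = ∑ j ∈ Finset.range N, if α z₀ = j then S j z₀ else 0

namespace HasShiftedInverseExpansion

variable {α f : ℂ → ℂ} {z₀ ρ : ℂ}

theorem meromorphicAt (h : HasShiftedInverseExpansion α f z₀ ρ) (hα : AnalyticAt ℂ α z₀) :
    MeromorphicAt f z₀ := by
  obtain ⟨N, A, S, hA, hS, hf, -⟩ := h
  exact meromorphicAt_of_eventuallyEq_sub_sum hα hA hS hf

theorem analyticAt (h : HasShiftedInverseExpansion α f z₀ ρ) (hα : AnalyticAt ℂ α z₀)
    (hz : α z₀ ∉ poleOrders n) : AnalyticAt ℂ f z₀ := by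
  obtain ⟨N, A, S, hA, hS, hf, -⟩ := h
  -- The expansion can be singular only at values `j ≥ 0`, which lie in `[-n, ∞) ∩ ℤ`.
  exact analyticAt_of_eventuallyEq_sub_sum hα hA hS hf fun j hj => hz ⟨j, by omega, by simp [hj]⟩

theorem hasSimplePole (h : HasShiftedInverseExpansion α f z₀ ρ) (hα : AnalyticAt ℂ α z₀)
    (hd : deriv α z₀ ≠ 0) : HasSimplePoleWithResidue f z₀ (-(1 / deriv α z₀) * ρ) := by
  obtain ⟨N, A, S, hA, hS, hf, rfl⟩ := h
  exact hasSimplePoleWithResidue_of_eventuallyEq_sub_sum hα hA hS hf hd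

end HasShiftedInverseExpansion

section Family

variable {W : Set ℂ} {α : ℂ → ℂ} {σ : ℂ → Eucl n × Eucl n → ℂ}

theorem HasHolomorphicOrder.hasFinitePart_cutoffIntegral (hW : IsOpen W)
    (hα : DifferentiableOn ℂ α W) (hσ : HasHolomorphicOrder U W (fun z => α z - n) σ) {z : ℂ}
    (hz : z ∈ W) {x : Eucl n} (hx : x ∈ U) :
    HasFinitePart (ballIntegral (σ z) x) (cutoffIntegral (σ z) x) := by
  obtain ⟨V, N, A, S, -, hzV, -, -, -, hf⟩ := hσ.exists_local_formula hW hα hz isCompact_singleton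
    (singleton_subset_iff.2 hx)
  have h := (hf z hzV x rfl).1
  rwa [cutoffIntegral, h.finitePart_eq]

theorem HasHolomorphicOrder.cutoffIntegral_expansion (hW : IsOpen W)
    (hα : DifferentiableOn ℂ α W) (hσ : HasHolomorphicOrder U W (fun z => α z - n) σ) {z₀ : ℂ}
    (hz₀ : z₀ ∈ W) {x : Eucl n} (hx : x ∈ U) :
    HasShiftedInverseExpansion α (fun z => cutoffIntegral (σ z) x) z₀
      (residueDensity U (σ z₀) x) := by
  obtain ⟨V, N, A, S, hV, hzV, -, hA, hS, hf⟩ := hσ.exists_local_formula hW hα hz₀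
    isCompact_singleton (singleton_subset_iff.2 hx)
  refine ⟨N, fun z => A z x, fun j z => S j z x, (hA.diff x rfl).analyticAt (hV.mem_nhds hzV),
    fun j => ((hS j).diff x rfl).analyticAt (hV.mem_nhds hzV), ?_, (hf z₀ hzV x rfl).2⟩
  filter_upwards [hV.mem_nhds hzV] with z hz using (hf z hz x rfl).1.finitePart_eq

theorem cutoffIntegral_eq_zero {τ : Eucl n × Eucl n → ℂ} {x : Eucl n} (h : ∀ ξ, τ (x, ξ) = 0) :
    cutoffIntegral τ x = 0 :=
  (HasFinitePart.of_tendsto (F := ballIntegral τ x) (c := 0) <| by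
    simp [funext fun r => (by simp [ballIntegral, h] : ballIntegral τ x r = 0)]).finitePart_eq

theorem residueDensity_eq_zero {τ : Eucl n × Eucl n → ℂ} {x : Eucl n} (hx : x ∈ U)
    (h : ∀ ξ, τ (x, ξ) = 0) : residueDensity U τ x = 0 := by
  simp [residueDensity, component_eq_zero hx (sphere_ne_zero _) _ h]

/-- The local formula over a compact set outside of which the family vanishes. -/
theorem HasHolomorphicOrder.setIntegral_cutoffIntegral (hU : IsOpen U) (hW : IsOpen W)
    (hα : DifferentiableOn ℂ α W) (hσ : HasHolomorphicOrder U W (fun z => α z - n) σ)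
    {K : Set (Eucl n)} (hK : IsCompact K) (hKU : K ⊆ U)
    (hKσ : ∀ z ∈ W, ∀ x, x ∉ K → ∀ ξ, σ z (x, ξ) = 0) {z₀ : ℂ} (hz₀ : z₀ ∈ W) :
    IntegrableOn (cutoffIntegral (σ z₀)) U ∧ IntegrableOn (residueDensity U (σ z₀)) U ∧
    HasShiftedInverseExpansion α (fun z => ∫ x in U, cutoffIntegral (σ z) x) z₀
      (∫ x in U, residueDensity U (σ z₀) x) := by
  obtain ⟨V, N, A, S, hV, hzV, hVW, hA, hS, hf⟩ := hσ.exists_local_formula hW hα hz₀ hK hKU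
  have hKm := hK.measurableSet
  have hKμ : (volume : Measure (Eucl n)) K ≠ ⊤ := hK.measure_lt_top.ne
  have hcut : ∀ z ∈ V, EqOn (cutoffIntegral (σ z))
      (fun x => A z x - ∑ j ∈ Finset.range N, (α z - j)⁻¹ * S j z x) K := fun z hz x hx =>
    (hf z hz x hx).1.finitePart_eq
  have hres : EqOn (residueDensity U (σ z₀))
      (fun x => ∑ j ∈ Finset.range N, if α z₀ = j then S j z₀ x else 0) K := fun x hx =>
    (hf z₀ hzV x hx).2
  have hcut0 : ∀ z ∈ W, ∀ x ∈ U \ K, cutoffIntegral (σ z) x = 0 := fun z hz x hx =>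
    cutoffIntegral_eq_zero (hKσ z hz x hx.2)
  have hres0 : ∀ x ∈ U \ K, residueDensity U (σ z₀) x = 0 := fun x hx =>
    residueDensity_eq_zero hx.1 (hKσ z₀ hz₀ x hx.2)
  have hAi : ∀ z ∈ V, IntegrableOn (A z) K := fun z hz => hA.integrableOn hKm hKμ hz
  have hSi : ∀ z ∈ V, ∀ j ∈ Finset.range N, IntegrableOn (fun x => (α z - j)⁻¹ * S j z x) K :=
    fun z hz j _ => ((hS j).integrableOn hKm hKμ hz).const_mul _
  have hRi : ∀ j ∈ Finset.range N, IntegrableOn (fun x => if α z₀ = j then S j z₀ x else 0) K :=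
    fun j _ => by
      split_ifs
      · exact (hS j).integrableOn hKm hKμ hzV
      · exact integrableOn_zero
  -- Both integrands vanish on `U \ K`, so every integral reduces to `K`. There the factors `(α z -
  -- j)⁻¹` do not depend on `x` and come out, which preserves the shape of the expansion.
  refine ⟨IntegrableOn.of_forall_sdiff_eq_zero (s := K) ?_ hU.measurableSet (hcut0 z₀ hz₀),
    IntegrableOn.of_forall_sdiff_eq_zero (s := K) ?_ hU.measurableSet hres0,
    N, fun z => ∫ x in K, A z x, fun j z => ∫ x in K, S j z x,
    (hA.differentiableOn_setIntegral hV hKm hKμ).analyticAt (hV.mem_nhds hzV),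
    fun j => ((hS j).differentiableOn_setIntegral hV hKm hKμ).analyticAt (hV.mem_nhds hzV), ?_, ?_⟩
  · exact IntegrableOn.congr_fun ((hAi z₀ hzV).sub (integrable_finsetSum _ (hSi z₀ hzV)))
      (hcut z₀ hzV).symm hKm
  · exact IntegrableOn.congr_fun (integrable_finsetSum _ hRi) hres.symm hKm
  · filter_upwards [hV.mem_nhds hzV] with z hz
    rw [setIntegral_eq_of_subset_of_forall_sdiff_eq_zero hU.measurableSet hKU (hcut0 z (hVW hz)),
      setIntegral_congr_fun hKm (hcut z hz), integral_sub (hAi z hz)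
      (integrable_finsetSum _ (hSi z hz)), integral_finsetSum _ (hSi z hz)]
    simp only [integral_const_mul]
  · rw [setIntegral_eq_of_subset_of_forall_sdiff_eq_zero hU.measurableSet hKU hres0,
      setIntegral_congr_fun hKm hres, integral_finsetSum _ hRi]
    refine Finset.sum_congr rfl fun j _ => ?_
    split_ifs <;> simp

end Family

end SymbolForms

theorem mainTheorem4 {n : ℕ} (U : Set (Eucl n)) (hU : IsOpen U)
    (W : Set ℂ) (hW : IsOpen W) (hWconn : IsPreconnected W) (hW0 : (0 : ℂ) ∈ W)
    (R : HolomorphicRegularisation U W) (ω : SymbolForm U)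
    (α : ℂ → ℂ) (hα : FormHasHolomorphicOrder U W α (R.onForms ω))
    (hα0 : deriv α 0 ≠ 0) :
    (∀ x ∈ U,
      (∀ z ∈ W, ∀ I : Finset (Fin n),
        HasFinitePart
          (ballIntegral (R.onForms ω z I Finset.univ) x)
          (fibreCutoff (R.onForms ω z) x I)) ∧
      MeromorphicOn (fun z => fibreCutoff (R.onForms ω z) x) W ∧
      (∀ z₀ ∈ W, α z₀ ∉ poleOrders n →
        AnalyticAt ℂ (fun z => fibreCutoff (R.onForms ω z) x) z₀) ∧
      (∀ z₀ ∈ W, deriv α z₀ ≠ 0 →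
        HasSimplePoleWithResidue
          (fun z => fibreCutoff (R.onForms ω z) x) z₀
          (-(1 / deriv α z₀) • fibreResidue U (R.onForms ω z₀) x)) ∧
      HasSimplePoleWithResidue
        (fun z => fibreCutoff (R.onForms ω z) x) 0
        (-(1 / deriv α 0) • fibreResidue U (R.onForms ω 0) x)) ∧
    ((∀ z ∈ W,
        IntegrableOn (cutoffIntegral (R.onForms ω z Finset.univ Finset.univ)) U ∧
        IntegrableOn (residueDensity U (R.onForms ω z Finset.univ Finset.univ)) U) ∧
      MeromorphicOn (fun z => totalCutoff U (R.onForms ω z)) W ∧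
      (∀ z₀ ∈ W, α z₀ ∉ poleOrders n →
        AnalyticAt ℂ (fun z => totalCutoff U (R.onForms ω z)) z₀) ∧
      (∀ z₀ ∈ W, deriv α z₀ ≠ 0 →
        HasSimplePoleWithResidue
          (fun z => totalCutoff U (R.onForms ω z)) z₀
          (-(1 / deriv α z₀) * totalResidue U (R.onForms ω z₀))) ∧
      HasSimplePoleWithResidue
        (fun z => totalCutoff U (R.onForms ω z)) 0
        (-(1 / deriv α 0) * totalResidue U (R.onForms ω 0))) := by
  -- The coefficient with `J = ∅` has order exactly `α`.
  have hαd : DifferentiableOn ℂ α W := by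
    refine ((hα ∅ ∅).1).congr fun z _ => ?_
    simp
  have hαa : ∀ z ∈ W, AnalyticAt ℂ α z := fun z hz => hαd.analyticAt (hW.mem_nhds hz)
  have hσ : ∀ I, HasHolomorphicOrder U W (fun z => α z - n)
      (fun z => R.onForms ω z I Finset.univ) := fun I => by
    simpa using hα I Finset.univ
  obtain ⟨K, hK, hKU, hKσ⟩ := (hσ Finset.univ).exists_common_compact_support hU hW hWconn ⟨0, hW0⟩
  have hfib : ∀ x ∈ U, ∀ z₀ ∈ W, ∀ I, HasShiftedInverseExpansion α
      (fun z => fibreCutoff (R.onForms ω z) x I) z₀ (fibreResidue U (R.onForms ω z₀) x I) :=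
    fun x hx z₀ hz₀ I => (hσ I).cutoffIntegral_expansion hW hαd hz₀ hx
  have htot : ∀ z₀ ∈ W, _ := fun z₀ hz₀ =>
    (hσ Finset.univ).setIntegral_cutoffIntegral hU hW hαd hK hKU hKσ hz₀
  have hfibpole : ∀ x ∈ U, ∀ z₀ ∈ W, deriv α z₀ ≠ 0 → HasSimplePoleWithResidue
      (fun z => fibreCutoff (R.onForms ω z) x) z₀
      (-(1 / deriv α z₀) • fibreResidue U (R.onForms ω z₀) x) := fun x hx z₀ hz₀ hd =>
    .pi fun I => (hfib x hx z₀ hz₀ I).hasSimplePole (hαa z₀ hz₀) hd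
  refine ⟨fun x hx => ⟨fun z hz I => (hσ I).hasFinitePart_cutoffIntegral hW hαd hz hx,
    fun z hz => .pi fun I => (hfib x hx z hz I).meromorphicAt (hαa z hz),
    fun z₀ hz₀ h => .pi fun I => (hfib x hx z₀ hz₀ I).analyticAt (hαa z₀ hz₀) h,
    hfibpole x hx, hfibpole x hx 0 hW0 hα0⟩,
    fun z hz => ⟨(htot z hz).1, (htot z hz).2.1⟩,
    fun z hz => (htot z hz).2.2.meromorphicAt (hαa z hz),
    fun z₀ hz₀ h => (htot z₀ hz₀).2.2.analyticAt (hαa z₀ hz₀) h,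
    fun z₀ hz₀ hd => (htot z₀ hz₀).2.2.hasSimplePole (hαa z₀ hz₀) hd,
    (htot 0 hW0).2.2.hasSimplePole (hαa 0 hW0) hα0⟩
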